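/- Let $n\ge 3$ and $0<v<4^{-n}/10^3$. Put $\delta=v^4$ and $\widetilde\delta=v^2$. All distances on the unit sphere $S^{n-1}\subset\mathbb R^n$ are spherical (angular), a rotation is an element of $SO(n)$, and for $\xi\in S^{n-1}$, $SO(n-1,\xi^\perp)$ denotes the rotations fixing $\xi$. A convex body is a compact convex set that is the closure of its non-empty interior; $A^*=\{x: x\cdot y\le 1\ \forall y\in A\}$ is the polar set; $A|\xi^\perp$ is the orthogonal projection of $A$ on the hyperplane $\xi^\perp$. Consider the following ingredients. (i) Points $\xi_1,\dots,\xi_n\in S^{n-1}$ at mutual distance $v$ (a regular spherical simplex); $\xi_1$ is taken as the north pole. (ii) Smooth bump functions $\varphi_{\xi,\delta}(u)=f(\xi\cdot u)$ and $\varphi_{\xi,\widetilde\delta}(u)=g(\xi\cdot u)$ on $S^{n-1}$, where $f,g:\mathbb R\to\mathbb R$ are $C^\infty$, non-decreasing on $[-1,1]$, $f(1)=g(1)=1$, $f(t)=0$ for $t\le\cos\delta$, $g(t)=0$ for $t\le\cos\widetilde\delta$, and $g(\cos(\widetilde\delta/2))\ge 10^{-3}$. (So $\varphi_{\xi,\delta}$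 is invariant under rotations fixing $\xi$, has height $1$ at $\xi$, decreases away from $\xi$ and vanishes outside the disk of radius $\delta$ about $\xi$; likewise for $\widetilde\delta$.) (iii) For each $I\subset\{1,\dots,n\}$ with $1\in I$ and $2\le |I|\le n-1$, a rotation $R_I$ that is the identity on the orthogonal complement of $\mathrm{span}\{\xi_i:i\in I\}$, and an even number $k_I$ with $1\le k_I\le 2^n-1$, the numbers $k_I$ being distinct for distinct $I$, such that the disks of radius $\widetilde\delta$ about the points $R_I\xi_i$, $i\in I$, lie in the layer $\{u\in S^{n-1}: (k_I-1)/2^n\le u\cdot\xi_1\le k_I/2^n\}$. Such ingredients exist: there are simplices as in (i) and bump functions as in (ii), and for every simplex as in (i) there are placements as in (iii). Moreover, for every choice of ingredients there is $\varepsilon_0>0$ such that for every $0<\varepsilon<\varepsilon_0$ the following holds. Let $K$ and $L$ be the star bodies with radial functions $$\rho_K(u)=1+\sum_{j=1}^n\frac{\varepsilon}{10^3}\,\varphi_{\xi_j,\delta}(u),\qquad \rho_L(u)=1+\sum_{j=2}^n\frac{\varepsilon}{10^3}\,\varphi_{\xi_j,\delta}(u)+\sum_{I}\sum_{i\in I}\varepsilon\,\varphi_{R_I\xi_i,\widetilde\delta}(u)+\frac{\varepsilon}{10^3}\,\psi(u)\qquad(u\in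 S^{n-1}),$$ where $\psi(u)=\sup\{\varphi_{e,\delta}(u): e\in S^{n-1},\ e\cdot\xi_1=0\}$ is the bump slid along the equator. Then: (a) $K$ and $L$ are convex bodies; for every $\xi\in S^{n-1}$ there is $\Phi\in SO(n-1,\xi^\perp)$ with $\Phi(K\cap\xi^\perp)\subseteq L\cap\xi^\perp$; and there is no $\Psi\in SO(n)$ with $\Psi(K)\subseteq L$. (b) $K^*$ and $L^*$ are convex bodies; for every $\xi\in S^{n-1}$ there is $\Phi\in SO(n-1,\xi^\perp)$ with $\Phi(L^*|\xi^\perp)\subseteq K^*|\xi^\perp$; and there is no $\Psi\in SO(n)$ with $\Psi(L^*)\subseteq K^*$. -/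

import Mathlib

noncomputable section

namespace BumpBodies

/-- Euclidean space `ℝⁿ`. -/
abbrev E (n : ℕ) : Type := EuclideanSpace ℝ (Fin n)

/-! ### Rotations, convex bodies, sections, projections, polar sets -/

/-- `Φ` belongs to `SO(n)`. -/
def IsRotation {n : ℕ} (Φ : E n ≃ₗᵢ[ℝ] E n) : Prop :=
  LinearMap.det (Φ.toLinearEquiv : E n →ₗ[ℝ] E n) = 1

/-- A convex body: a compact convex set which is the closure of its non-empty interior. -/
def IsConvexBody {n : ℕ} (K : Set (E n)) : Prop :=
  IsCompact K ∧ (interior K).Nonempty ∧ K = closure (interior K) ∧ Convex ℝ K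

/-- The section `K ∩ ξ^⊥`. -/
def hyperplaneSection {n : ℕ} (K : Set (E n)) (ξ : E n) : Set (E n) :=
  K ∩ {x | inner ℝ x ξ = 0}

/-- The orthogonal projection `K | ξ^⊥`. -/
def hyperplaneProjection {n : ℕ} (K : Set (E n)) (ξ : E n) : Set (E n) :=
  (fun x => (Submodule.span ℝ {ξ})ᗮ.starProjection x) '' K

/-- The polar set `A^* = {x : x · y ≤ 1 for every y ∈ A}`. -/
def polarSet {n : ℕ} (A : Set (E n)) : Set (E n) :=
  {x | ∀ y ∈ A, inner ℝ x y ≤ 1}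

/-- Some rotation in `SO(n-1, ξ^⊥)`, i.e. a rotation of `ℝⁿ` fixing `ξ`, carries `A` into `B`. -/
def RotatesIntoAbout {n : ℕ} (ξ : E n) (A B : Set (E n)) : Prop :=
  ∃ Φ : E n ≃ₗᵢ[ℝ] E n, IsRotation Φ ∧ Φ ξ = ξ ∧ Φ '' A ⊆ B

/-- Every central hyperplane section of `K` can be rotated, inside its hyperplane, into the
corresponding section of `L`. -/
def SectionsRotateInto {n : ℕ} (K L : Set (E n)) : Prop :=
  ∀ ξ : E n, ‖ξ‖ = 1 → RotatesIntoAbout ξ (hyperplaneSection K ξ) (hyperplaneSection L ξ)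

/-- Every hyperplane projection of `K` can be rotated, inside its hyperplane, into the
corresponding projection of `L`. -/
def ProjectionsRotateInto {n : ℕ} (K L : Set (E n)) : Prop :=
  ∀ ξ : E n, ‖ξ‖ = 1 → RotatesIntoAbout ξ (hyperplaneProjection K ξ) (hyperplaneProjection L ξ)

/-- `L` contains a rotation of `K`. -/
def ContainsRotationOf {n : ℕ} (L K : Set (E n)) : Prop :=
  ∃ Ψ : E n ≃ₗᵢ[ℝ] E n, IsRotation Ψ ∧ Ψ '' K ⊆ L

/-! ### Bumps on the sphere -/

/-- The star body whose radial function on the unit sphere is the (non-negative) function `ρ`. -/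
def bodyOfRadial {n : ℕ} (ρ : E n → ℝ) : Set (E n) :=
  {x | ∃ u : E n, ‖u‖ = 1 ∧ ∃ c : ℝ, 0 ≤ c ∧ c ≤ ρ u ∧ x = c • u}

/-- `f` is the profile of a smooth bump of spherical radius `δ` and height `1`. The bump centred
at the unit vector `ξ` is `u ↦ f (ξ · u)`: a smooth function on the sphere, invariant under the
rotations that fix `ξ`, vanishing outside the disk of spherical radius `δ` about `ξ`, equal to `1`
at `ξ`, and non-increasing in the distance to `ξ`. -/
structure IsBumpProfile (δ : ℝ) (f : ℝ → ℝ) : Prop where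
  smooth : ContDiff ℝ (⊤ : ℕ∞) f
  support : ∀ t, t ≤ Real.cos δ → f t = 0
  height : f 1 = 1
  mono : MonotoneOn f (Set.Icc (-1) 1)

/-- The bump with profile `f` centred at `ξ`. -/
def bump {n : ℕ} (f : ℝ → ℝ) (ξ u : E n) : ℝ := f (inner ℝ ξ u)

/-- The bump with profile `f` slid around the equator `{e : ‖e‖ = 1, e · p = 0}` of the pole `p`:
the upper envelope of the bumps centred on the equator. -/
def equatorBump {n : ℕ} (f : ℝ → ℝ) (p u : E n) : ℝ :=
  ⨆ e : {e : E n // ‖e‖ = 1 ∧ inner ℝ e p = 0}, bump f e.1 u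

/-- `ξ` lists the vertices of a regular spherical simplex with edge length `v`: there are `n` unit
vectors at mutual spherical distance `v`. The vertex `ξ 0` serves as the north pole. -/
structure IsRegularSimplex {n : ℕ} (v : ℝ) (ξ : Fin n → E n) : Prop where
  norm_eq : ∀ i, ‖ξ i‖ = 1
  dist_eq : ∀ i j, i ≠ j → InnerProductGeometry.angle (ξ i) (ξ j) = v

/-- The sub-configurations: sets of `j` vertices, `2 ≤ j ≤ n - 1`, one of which is the pole. -/
def subConfigs (n : ℕ) [NeZero n] : Finset (Finset (Fin n)) :=
  Finset.univ.filter fun I => (0 : Fin n) ∈ I ∧ 2 ≤ I.card ∧ I.card < n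

/-- The `k`-th layer of the upper half sphere with pole `p`: the points of the sphere with height
between `(k-1)/2ⁿ` and `k/2ⁿ`. -/
def layer {n : ℕ} (p : E n) (k : ℕ) : Set (E n) :=
  {u | ‖u‖ = 1 ∧ ((k : ℝ) - 1) / 2 ^ n ≤ inner ℝ p u ∧ inner ℝ p u ≤ (k : ℝ) / 2 ^ n}

/-- `R` and `k` describe the layered copies: each sub-configuration `I` is moved by a rotation
`R I` of its own linear span (trivial on the orthogonal complement of the span) into the layer
number `k I`, so that the disks of radius `v²` about the moved vertices lie in that layer. Only
even layers below the top layer (number `2ⁿ`) are used, and each for at most one `I`. -/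
structure IsLayeredPlacement {n : ℕ} [NeZero n] (v : ℝ) (ξ : Fin n → E n)
    (R : Finset (Fin n) → (E n ≃ₗᵢ[ℝ] E n)) (k : Finset (Fin n) → ℕ) : Prop where
  rotation : ∀ I ∈ subConfigs n, IsRotation (R I)
  within_span : ∀ I ∈ subConfigs n, ∀ x ∈ (Submodule.span ℝ (ξ '' I))ᗮ, R I x = x
  index_even : ∀ I ∈ subConfigs n, Even (k I)
  index_range : ∀ I ∈ subConfigs n, 1 ≤ k I ∧ k I < 2 ^ n
  index_inj : Set.InjOn k (subConfigs n)
  mem_layer : ∀ I ∈ subConfigs n, ∀ i ∈ I, ∀ u : E n, ‖u‖ = 1 →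
    InnerProductGeometry.angle (R I (ξ i)) u ≤ v ^ 2 → u ∈ layer (ξ 0) (k I)

/-- The body `K`: the unit ball with a bump of height `ε/10³` at each vertex of the simplex. -/
def bodyK {n : ℕ} (ε : ℝ) (f : ℝ → ℝ) (ξ : Fin n → E n) : Set (E n) :=
  bodyOfRadial fun u => 1 + ∑ i, ε / 10 ^ 3 * bump f (ξ i) u

/-- The body `L`: the unit ball with a bump of height `ε/10³` (profile `f`) at each vertex of the
simplex other than the pole, a bump of height `ε` (profile `g`) at each vertex of each layered
copy, and a bump of height `ε/10³` (profile `f`) slid around the equator. -/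
def bodyL {n : ℕ} [NeZero n] (ε : ℝ) (f g : ℝ → ℝ) (ξ : Fin n → E n)
    (R : Finset (Fin n) → (E n ≃ₗᵢ[ℝ] E n)) : Set (E n) :=
  bodyOfRadial fun u =>
    1 + ∑ i ∈ Finset.univ.erase 0, ε / 10 ^ 3 * bump f (ξ i) u
      + ∑ I ∈ subConfigs n, ∑ i ∈ I, ε * bump g (R I (ξ i)) u
      + ε / 10 ^ 3 * equatorBump f (ξ 0) u

end BumpBodies

end

open BumpBodies

namespace BumpBodies

/-! ### Rotations -/

/-! Sections. Fix `θ` and let `I` be the set of vertices whose bump in `K` meets `θ^⊥`. If the pole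
is not in `I`, the identity works, since `L` keeps all the other bumps. `I` is never the whole
simplex, because no hyperplane is close to all vertices (`exists_lt_abs_inner`). If `I` is the pole
alone, its bump can be turned inside `θ^⊥` to a point of the equator, under the slid bump
(`exists_rotation_le_equatorBump`). Otherwise `I` is a sub-configuration, and `θ` is almost
orthogonal to its span, so `R I` almost fixes `θ`. Conjugating `R I` by a small rotation gives a
rotation that fixes `θ` exactly and moves the vertices in `I` almost as `R I` does
(`exists_rotation_close`). The error is far below the width `v ^ 2` of the bumps of the layered
copy, which still have height `ε / 10 ^ 3` there.

Non-containment. If `Ψ K ⊆ L`, every `Ψ (ξ i)` lies where `L` exceeds the ball: near a vertex other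
than the pole, near a layered copy, or near the equator (`trichotomy_of_one_lt_radialL`). The
heights above the equator of these families differ by more than `v`, the edge length, so the whole
moved simplex sits in a single family. The vertex family and each layered copy offer fewer than `n`
spots, each too small for two vertices, and the equator would be a hyperplane close to all vertices.

Convexity holds because a small `C^{1,1}` perturbation of the ball has a supporting hyperplane at
each boundary point. The statement on projections is the polar of the one on sections
(`SectionsRotateInto.polarSet`), and non-containment passes to polars by the bipolar theorem. -/

theorem IsRotation.mul {n : ℕ} {S T : E n ≃ₗᵢ[ℝ] E n} (hS : IsRotation S) (hT : IsRotation T) :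
    IsRotation (S * T) := by
  unfold IsRotation at *
  have : (((S * T : E n ≃ₗᵢ[ℝ] E n).toLinearEquiv : E n ≃ₗ[ℝ] E n) : E n →ₗ[ℝ] E n)
      = (S.toLinearEquiv : E n →ₗ[ℝ] E n) * (T.toLinearEquiv : E n →ₗ[ℝ] E n) := rfl
  rw [this, map_mul, hS, hT, one_mul]

theorem isRotation_one {n : ℕ} : IsRotation (1 : E n ≃ₗᵢ[ℝ] E n) := by
  have : (((1 : E n ≃ₗᵢ[ℝ] E n).toLinearEquiv : E n ≃ₗ[ℝ] E n) : E n →ₗ[ℝ] E n) = 1 := rfl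
  rw [IsRotation, this, map_one]

theorem IsRotation.inv {n : ℕ} {S : E n ≃ₗᵢ[ℝ] E n} (hS : IsRotation S) : IsRotation S⁻¹ := by
  unfold IsRotation at *
  have h : ((S⁻¹ : E n ≃ₗᵢ[ℝ] E n).toLinearEquiv : E n →ₗ[ℝ] E n)
      * (S.toLinearEquiv : E n →ₗ[ℝ] E n) = 1 := by
    ext1 x
    exact S.symm_apply_apply x
  have h2 := congrArg LinearMap.det h
  rwa [map_mul, hS, mul_one, map_one] at h2

/-- Both line reflections have the same determinant, `-1` to the dimension of the orthogonal
complement of a line, so the product has determinant `1`. -/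
theorem isRotation_reflection_mul_reflection {n : ℕ} {p q : E n} (hp : p ≠ 0) (hq : q ≠ 0) :
    IsRotation ((ℝ ∙ q).reflection * (ℝ ∙ p).reflection) := by
  have h : ∀ a b : E n ≃ₗᵢ[ℝ] E n, ((a * b : E n ≃ₗᵢ[ℝ] E n).toLinearEquiv : E n →ₗ[ℝ] E n)
      = (a.toLinearEquiv : E n →ₗ[ℝ] E n) * (b.toLinearEquiv : E n →ₗ[ℝ] E n) := fun _ _ => rfl
  have hfin : Module.finrank ℝ (ℝ ∙ q)ᗮ = Module.finrank ℝ (ℝ ∙ p)ᗮ := by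
    have h1 := (ℝ ∙ q).finrank_add_finrank_orthogonal
    have h2 := (ℝ ∙ p).finrank_add_finrank_orthogonal
    rw [finrank_span_singleton hq] at h1
    rw [finrank_span_singleton hp] at h2
    omega
  rw [IsRotation, h, map_mul, Submodule.det_reflection, Submodule.det_reflection, hfin, ← pow_add]
  exact Even.neg_one_pow ⟨_, rfl⟩

theorem inner_self_of_norm_one {n : ℕ} {a : E n} (ha : ‖a‖ = 1) : inner ℝ a a = (1 : ℝ) := by
  rw [real_inner_self_eq_norm_sq, ha, one_pow]

theorem norm_sub_sq_of_norm_one {n : ℕ} {a b : E n} (ha : ‖a‖ = 1) (hb : ‖b‖ = 1) :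
    ‖a - b‖ ^ 2 = 2 - 2 * inner ℝ a b := by
  rw [norm_sub_sq_real, ha, hb]; ring

theorem reflection_line_of_norm_one {n : ℕ} {q : E n} (hq : ‖q‖ = 1) (x : E n) :
    (ℝ ∙ q).reflection x = (2 * inner ℝ q x) • q - x := by
  rw [Submodule.reflection_singleton_apply, hq]
  simp [mul_smul, two_smul]

/-- The rotation taking `a` to `b` in their plane, trivial on the orthogonal complement. -/
theorem exists_rotation_apply_eq {n : ℕ} {a b : E n} (ha : ‖a‖ = 1) (hb : ‖b‖ = 1)
    (hab : 0 ≤ inner ℝ a b) :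
    ∃ S : E n ≃ₗᵢ[ℝ] E n, IsRotation S ∧ S a = b ∧
      (∀ x, inner ℝ a x = 0 → inner ℝ b x = 0 → S x = x) ∧
      ∀ x, ‖S x - x‖ ≤ 4 * ‖a - b‖ * ‖x‖ := by
  set c : ℝ := inner ℝ a b with hc
  have hs2 : ‖a + b‖ ^ 2 = 2 + 2 * c := by rw [norm_add_sq_real, ha, hb]; ring
  have hspos : 0 < ‖a + b‖ := by
    by_contra h
    have : ‖a + b‖ = 0 := le_antisymm (not_lt.1 h) (norm_nonneg _)
    rw [this] at hs2; nlinarith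
  -- The unit bisector of `a` and `b`: reflecting in the line of `a` and then in the line of `q`
  -- takes `a` to `b`.
  set q : E n := ‖a + b‖⁻¹ • (a + b) with hqdef
  have hq : ‖q‖ = 1 := by
    rw [hqdef, norm_smul, norm_inv, norm_norm, inv_mul_cancel₀ hspos.ne']
  have hqa : inner ℝ q a = ‖a + b‖⁻¹ * (1 + c) := by
    rw [hqdef, real_inner_smul_left, inner_add_left, inner_self_of_norm_one ha,
      real_inner_comm a b]
  refine ⟨(ℝ ∙ q).reflection * (ℝ ∙ a).reflection, isRotation_reflection_mul_reflection ?_ ?_,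
    ?_, ?_, ?_⟩
  · rintro rfl; simp at ha
  · intro h; simp [h] at hq
  · change (ℝ ∙ q).reflection ((ℝ ∙ a).reflection a) = b
    rw [reflection_line_of_norm_one ha, inner_self_of_norm_one ha, reflection_line_of_norm_one hq]
    have e : (2 * 1 : ℝ) • a - a = a := by rw [mul_one, two_smul, add_sub_cancel_right]
    rw [e, hqa, hqdef, smul_smul]
    have : 2 * (‖a + b‖⁻¹ * (1 + c)) * ‖a + b‖⁻¹ = 1 := by
      field_simp
      linarith
    rw [this, one_smul, add_sub_cancel_left]
  · intro x hax hbx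
    change (ℝ ∙ q).reflection ((ℝ ∙ a).reflection x) = x
    have hqx : inner ℝ q x = 0 := by
      rw [hqdef, real_inner_smul_left, inner_add_left, hax, hbx]; simp
    rw [reflection_line_of_norm_one ha, hax, reflection_line_of_norm_one hq]
    simp [hqx, inner_neg_right]
  · intro x
    change ‖(ℝ ∙ q).reflection ((ℝ ∙ a).reflection x) - x‖ ≤ _
    have haq : ‖a - q‖ ≤ ‖a - b‖ := by
      have h1 : ‖a - q‖ ^ 2 ≤ ‖a - b‖ ^ 2 := by
        rw [norm_sub_sq_of_norm_one ha hq, norm_sub_sq_of_norm_one ha hb, real_inner_comm, hqa,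
          ← hc]
        have hc1 : c ≤ 1 := by
          have := real_inner_le_norm a b
          rwa [ha, hb, one_mul] at this
        have hs : ‖a + b‖ ≤ 2 := by nlinarith
        have : (1 / 2 : ℝ) ≤ ‖a + b‖⁻¹ := by
          rw [one_div]; exact inv_anti₀ hspos hs
        nlinarith
      exact (sq_le_sq₀ (norm_nonneg _) (norm_nonneg _)).1 h1
    -- The reflection in `q` is an isometric involution, so the displacement of `x` is the distance
    -- between its two reflections.
    have h1 : (ℝ ∙ q).reflection ((ℝ ∙ a).reflection x) - x
        = (ℝ ∙ q).reflection ((ℝ ∙ a).reflection x - (ℝ ∙ q).reflection x) := by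
      rw [map_sub, Submodule.reflection_reflection]
    rw [h1, LinearIsometryEquiv.norm_map, reflection_line_of_norm_one ha,
      reflection_line_of_norm_one hq]
    have h2 : (2 * inner ℝ a x) • a - x - ((2 * inner ℝ q x) • q - x)
        = (2 * inner ℝ a x) • (a - q) + (2 * inner ℝ (a - q) x) • q := by
      rw [inner_sub_left]; module
    rw [h2]
    have h3 := abs_real_inner_le_norm a x
    have h4 := abs_real_inner_le_norm (a - q) x
    rw [ha, one_mul] at h3
    refine (norm_add_le _ _).trans ?_
    rw [norm_smul, norm_smul, hq, Real.norm_eq_abs, Real.norm_eq_abs, abs_mul, abs_mul, abs_two]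
    have h5 : |inner ℝ a x| * ‖a - q‖ ≤ ‖x‖ * ‖a - q‖ := by gcongr
    have h6 : ‖a - q‖ * ‖x‖ ≤ ‖a - b‖ * ‖x‖ := by gcongr
    nlinarith

/-! ### Star bodies and their radial functions -/

theorem smul_mem_bodyOfRadial_iff {n : ℕ} {ρ : E n → ℝ} (hρ : ∀ u, ‖u‖ = 1 → 0 ≤ ρ u)
    {u : E n} (hu : ‖u‖ = 1) {c : ℝ} (hc : 0 ≤ c) : c • u ∈ bodyOfRadial ρ ↔ c ≤ ρ u := by
  constructor
  · rintro ⟨w, hw, d, hd, hdw, h⟩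
    rcases hc.eq_or_lt with rfl | hpos
    · exact hρ u hu
    have hcd : c = d := by
      have := congrArg norm h
      rwa [norm_smul, norm_smul, hu, hw, mul_one, mul_one, Real.norm_of_nonneg hc,
        Real.norm_of_nonneg hd] at this
    subst hcd
    rwa [smul_right_injective _ hpos.ne' h]
  · exact fun h => ⟨u, hu, c, hc, h, rfl⟩

theorem exists_unit_smul {n : ℕ} [NeZero n] (x : E n) : ∃ u : E n, ‖u‖ = 1 ∧ x = ‖x‖ • u := by
  by_cases hx : x = 0
  · exact ⟨EuclideanSpace.single 0 1, by simp, by simp [hx]⟩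
  · refine ⟨‖x‖⁻¹ • x, ?_, ?_⟩
    · rw [norm_smul, norm_inv, norm_norm, inv_mul_cancel₀ (norm_ne_zero_iff.2 hx)]
    · rw [smul_smul, mul_inv_cancel₀ (norm_ne_zero_iff.2 hx), one_smul]

theorem rotatesIntoAbout_section {n : ℕ} {ρ σ : E n → ℝ} {ξ : E n}
    (hσ : ∀ u, ‖u‖ = 1 → 0 ≤ σ u) {Φ : E n ≃ₗᵢ[ℝ] E n} (hΦ : IsRotation Φ) (hξ : Φ ξ = ξ)
    (h : ∀ u, ‖u‖ = 1 → inner ℝ u ξ = 0 → ρ u ≤ σ (Φ u)) :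
    RotatesIntoAbout ξ (hyperplaneSection (bodyOfRadial ρ) ξ)
      (hyperplaneSection (bodyOfRadial σ) ξ) := by
  refine ⟨Φ, hΦ, hξ, ?_⟩
  rintro _ ⟨x, ⟨⟨u, hu, c, hc, hcu, rfl⟩, hx⟩, rfl⟩
  have hx' : inner ℝ (c • u) ξ = 0 := hx
  constructor
  · rcases hc.eq_or_lt with rfl | hpos
    · exact ⟨Φ u, by rw [Φ.norm_map, hu], 0, le_rfl, hσ _ (by rw [Φ.norm_map, hu]), by simp⟩
    · rw [real_inner_smul_left, mul_eq_zero] at hx'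
      exact ⟨Φ u, by rw [Φ.norm_map, hu], c, hc,
        hcu.trans (h u hu (hx'.resolve_left hpos.ne')), by simp⟩
  · change inner ℝ (Φ (c • u)) ξ = 0
    rw [← hξ, Φ.inner_map_map, hx']

theorem not_containsRotationOf_of_radial {n : ℕ} {ρ σ : E n → ℝ} (hρ : ∀ u, ‖u‖ = 1 → 0 ≤ ρ u)
    (hσ : ∀ u, ‖u‖ = 1 → 0 ≤ σ u)
    (h : ∀ Ψ : E n ≃ₗᵢ[ℝ] E n, ∃ u, ‖u‖ = 1 ∧ σ (Ψ u) < ρ u) :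
    ¬ ContainsRotationOf (bodyOfRadial σ) (bodyOfRadial ρ) := by
  rintro ⟨Ψ, -, hΨ⟩
  obtain ⟨u, hu, hlt⟩ := h Ψ
  have h1 : ρ u • u ∈ bodyOfRadial ρ := ⟨u, hu, _, hρ u hu, le_rfl, rfl⟩
  have h2 := hΨ ⟨_, h1, rfl⟩
  rw [map_smul, smul_mem_bodyOfRadial_iff hσ (by rw [Ψ.norm_map, hu]) (hρ u hu)] at h2
  exact absurd h2 (not_le.2 hlt)

/-! ### Convexity of small perturbations of the ball -/

theorem isConvexBody_of_closedBall_subset {n : ℕ} {A : Set (E n)} (hc : IsClosed A)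
    (hconv : Convex ℝ A) {r R : ℝ} (hr : 0 < r) (hball : Metric.closedBall 0 r ⊆ A)
    (hbdd : A ⊆ Metric.closedBall 0 R) : IsConvexBody A := by
  have hint : (interior A).Nonempty :=
    ⟨0, interior_mono hball (Metric.ball_subset_interior_closedBall (Metric.mem_ball_self hr))⟩
  refine ⟨(isCompact_closedBall _ _).of_isClosed_subset hc hbdd, hint, ?_, hconv⟩
  rw [hconv.closure_interior_eq_closure_of_nonempty_interior hint, hc.closure_eq]

theorem closedBall_subset_bodyOfRadial {n : ℕ} [NeZero n] {ρ : E n → ℝ}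
    (h1 : ∀ u, ‖u‖ = 1 → 1 ≤ ρ u) : Metric.closedBall 0 1 ⊆ bodyOfRadial ρ := by
  intro x hx
  obtain ⟨u, hu, hxu⟩ := exists_unit_smul x
  exact ⟨u, hu, ‖x‖, norm_nonneg x, (mem_closedBall_zero_iff.1 hx).trans (h1 u hu), hxu⟩

/-- A supporting half-space at each boundary point exhibits the body as an intersection of closed
half-spaces. -/
theorem isConvexBody_bodyOfRadial {n : ℕ} [NeZero n] {ρ : E n → ℝ} {R : ℝ}
    (h1 : ∀ u, ‖u‖ = 1 → 1 ≤ ρ u) (hR : ∀ u, ‖u‖ = 1 → ρ u ≤ R)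
    (hsupp : ∀ u, ‖u‖ = 1 → ∃ y : E n, ρ u * inner ℝ y u = 1 ∧
      ∀ w, ‖w‖ = 1 → ρ w * inner ℝ y w ≤ 1) : IsConvexBody (bodyOfRadial ρ) := by
  choose! y hy hyw using hsupp
  have heq : bodyOfRadial ρ = ⋂ u ∈ {u : E n | ‖u‖ = 1}, {x | inner ℝ (y u) x ≤ 1} := by
    ext x
    simp only [Set.mem_iInter, Set.mem_ofPred_eq]
    constructor
    · rintro ⟨w, hw, c, hc, hcw, rfl⟩ u hu
      rw [real_inner_smul_right]
      rcases le_total (inner ℝ (y u) w) 0 with h | h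
      · nlinarith
      · exact (mul_le_mul_of_nonneg_right hcw h).trans (hyw u hu w hw)
    · intro h
      obtain ⟨u, hu, hxu⟩ := exists_unit_smul x
      refine ⟨u, hu, ‖x‖, norm_nonneg x, ?_, hxu⟩
      have h2 := h u hu
      rw [hxu, real_inner_smul_right] at h2
      have h3 := hy u hu
      have h4 := h1 u hu
      have h5 : 0 < inner ℝ (y u) u := by
        by_contra hneg
        nlinarith
      rw [← h3] at h2
      exact le_of_mul_le_mul_right h2 h5
  refine isConvexBody_of_closedBall_subset (r := 1) (R := R) ?_ ?_ one_pos
    (closedBall_subset_bodyOfRadial h1) ?_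
  · rw [heq]
    exact isClosed_biInter fun u _ =>
      isClosed_le (continuous_const.inner continuous_id) continuous_const
  · rw [heq]
    exact convex_iInter₂ fun u _ => convex_halfSpace_le (innerSL ℝ (y u)).isLinear 1
  · rintro _ ⟨w, hw, c, hc, hcw, rfl⟩
    rw [mem_closedBall_zero_iff, norm_smul, hw, mul_one, Real.norm_of_nonneg hc]
    exact hcw.trans (hR w hw)

/-- `q` is bounded and differentiable on the sphere with a uniform quadratic remainder. -/
def SphereC11 {n : ℕ} (q : E n → ℝ) : Prop :=
  ∃ C : ℝ, 0 ≤ C ∧ ∀ u, ‖u‖ = 1 → |q u| ≤ C ∧ ∃ t : E n, ‖t‖ ≤ C ∧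
    ∀ w, ‖w‖ = 1 → |q w - q u - inner ℝ t (w - u)| ≤ C * ‖w - u‖ ^ 2

theorem SphereC11.add {n : ℕ} {p q : E n → ℝ} (hp : SphereC11 p) (hq : SphereC11 q) :
    SphereC11 fun u => p u + q u := by
  obtain ⟨C, hC, h⟩ := hp
  obtain ⟨D, hD, k⟩ := hq
  refine ⟨C + D, by positivity, fun u hu => ?_⟩
  obtain ⟨h0, t, ht, h1⟩ := h u hu
  obtain ⟨k0, s, hs, k1⟩ := k u hu
  refine ⟨(abs_add_le _ _).trans (add_le_add h0 k0), t + s,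
    (norm_add_le _ _).trans (add_le_add ht hs), fun w hw => ?_⟩
  have e : p w + q w - (p u + q u) - inner ℝ (t + s) (w - u)
      = (p w - p u - inner ℝ t (w - u)) + (q w - q u - inner ℝ s (w - u)) := by
    rw [inner_add_left]; ring
  rw [e, add_mul]
  exact (abs_add_le _ _).trans (add_le_add (h1 w hw) (k1 w hw))

theorem SphereC11.const_mul {n : ℕ} {q : E n → ℝ} (hq : SphereC11 q) (a : ℝ) :
    SphereC11 fun u => a * q u := by
  obtain ⟨C, hC, h⟩ := hq
  refine ⟨|a| * C, by positivity, fun u hu => ?_⟩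
  obtain ⟨h0, t, ht, h1⟩ := h u hu
  refine ⟨?_, a • t, ?_, fun w hw => ?_⟩
  · rw [abs_mul]; gcongr
  · rw [norm_smul, Real.norm_eq_abs]; gcongr
  · have e : a * q w - a * q u - inner ℝ (a • t) (w - u)
        = a * (q w - q u - inner ℝ t (w - u)) := by
      rw [real_inner_smul_left]; ring
    rw [e, abs_mul, mul_assoc]
    exact mul_le_mul_of_nonneg_left (h1 w hw) (abs_nonneg a)

theorem SphereC11.zero {n : ℕ} : SphereC11 fun _ : E n => 0 :=
  ⟨0, le_rfl, fun _ _ => ⟨by simp, 0, by simp, fun _ _ => by simp⟩⟩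

theorem SphereC11.sum {n : ℕ} {ι : Type*} (s : Finset ι) {q : ι → E n → ℝ}
    (hq : ∀ i ∈ s, SphereC11 (q i)) : SphereC11 fun u => ∑ i ∈ s, q i u := by
  classical
  induction s using Finset.induction_on with
  | empty => simpa using SphereC11.zero
  | insert a s ha ih =>
    simp only [Finset.sum_insert ha]
    exact (hq a (Finset.mem_insert_self a s)).add
      (ih fun i hi => hq i (Finset.mem_insert_of_mem hi))

theorem SphereC11.congr {n : ℕ} {p q : E n → ℝ} (hp : SphereC11 p)
    (h : ∀ u, ‖u‖ = 1 → q u = p u) : SphereC11 q := by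
  obtain ⟨C, hC, k⟩ := hp
  refine ⟨C, hC, fun u hu => ?_⟩
  obtain ⟨h0, t, ht, h1⟩ := k u hu
  exact ⟨by rwa [h u hu], t, ht, fun w hw => by rw [h u hu, h w hw]; exact h1 w hw⟩

theorem exists_taylor_bound {F : ℝ → ℝ} (hF : ContDiff ℝ 2 F) :
    ∃ C, 0 ≤ C ∧ ∀ r ∈ Set.Icc (-1 : ℝ) 1, |F r| ≤ C ∧ |deriv F r| ≤ C ∧
      ∀ s ∈ Set.Icc (-1 : ℝ) 1, |F s - F r - deriv F r * (s - r)| ≤ C * (s - r) ^ 2 := by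
  have hdF : ContDiff ℝ 1 (deriv F) := by
    have : ContDiff ℝ (1 + 1) F := by simpa [one_add_one_eq_two] using hF
    exact (contDiff_succ_iff_deriv.1 this).2.2
  have hddF : Continuous (deriv (deriv F)) := hdF.continuous_deriv le_rfl
  have bound : ∀ G : ℝ → ℝ, Continuous G → ∃ C, ∀ r ∈ Set.Icc (-1 : ℝ) 1, ‖G r‖ ≤ C :=
    fun G hG => isCompact_Icc.exists_bound_of_continuousOn hG.continuousOn
  obtain ⟨A, hA⟩ := bound F hF.continuous
  obtain ⟨B, hB⟩ := bound _ hdF.continuous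
  obtain ⟨D, hD⟩ := bound _ hddF
  have h0 : (0 : ℝ) ∈ Set.Icc (-1 : ℝ) 1 := by constructor <;> norm_num
  have hA0 := (norm_nonneg _).trans (hA 0 h0)
  have hB0 := (norm_nonneg _).trans (hB 0 h0)
  have hD0 := (norm_nonneg _).trans (hD 0 h0)
  have hdiff : Differentiable ℝ F := hF.differentiable (by norm_num)
  have hddiff : Differentiable ℝ (deriv F) := hdF.differentiable (by norm_num)
  have hlip : ∀ r ∈ Set.Icc (-1 : ℝ) 1, ∀ s ∈ Set.Icc (-1 : ℝ) 1,
      ‖deriv F s - deriv F r‖ ≤ D * ‖s - r‖ := fun r hr s hs =>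
    (convex_Icc (-1 : ℝ) 1).norm_image_sub_le_of_norm_hasDerivWithin_le
      (fun x _ => (hddiff x).hasDerivAt.hasDerivWithinAt) hD hr hs
  refine ⟨A + B + D, by positivity, fun r hr => ⟨?_, ?_, fun s hs => ?_⟩⟩
  · have := hA r hr; rw [Real.norm_eq_abs] at this; linarith
  · have := hB r hr; rw [Real.norm_eq_abs] at this; linarith
  have hsub : Set.uIcc r s ⊆ Set.Icc (-1 : ℝ) 1 := Set.uIcc_subset_Icc hr hs
  -- Mean value inequality for `F` minus its linear part at `r`, whose derivative is at most `D * |s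
  -- - r|` between `r` and `s`.
  have key := (convex_uIcc r s).norm_image_sub_le_of_norm_hasDerivWithin_le
    (f := fun x => F x - deriv F r * x) (f' := fun x => deriv F x - deriv F r)
    (C := D * |s - r|) (x := r) (y := s)
    (fun x _ => ((hdiff x).hasDerivAt.sub
      (by simpa using (hasDerivAt_id x).const_mul (deriv F r))).hasDerivWithinAt)
    (fun x hx => (hlip r hr x (hsub hx)).trans (by
      rw [Real.norm_eq_abs]
      exact mul_le_mul_of_nonneg_left (Set.abs_sub_left_of_mem_uIcc hx) hD0))
    Set.left_mem_uIcc Set.right_mem_uIcc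
  have e : F s - F r - deriv F r * (s - r) = F s - deriv F r * s - (F r - deriv F r * r) := by ring
  rw [e, ← Real.norm_eq_abs]
  refine key.trans ?_
  rw [Real.norm_eq_abs, mul_assoc, ← sq, sq_abs]
  gcongr
  linarith

theorem sphereC11_comp_inner {n : ℕ} {F : ℝ → ℝ} (hF : ContDiff ℝ 2 F) {ξ : E n} (hξ : ‖ξ‖ = 1) :
    SphereC11 fun u => F (inner ℝ ξ u) := by
  obtain ⟨C, hC, h⟩ := exists_taylor_bound hF
  have hmem : ∀ u : E n, ‖u‖ = 1 → inner ℝ ξ u ∈ Set.Icc (-1 : ℝ) 1 := fun u hu =>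
    abs_le.1 (by simpa [hξ, hu] using abs_real_inner_le_norm ξ u)
  refine ⟨C, hC, fun u hu => ?_⟩
  obtain ⟨h0, h1, h2⟩ := h _ (hmem u hu)
  refine ⟨h0, deriv F (inner ℝ ξ u) • ξ, by rwa [norm_smul, hξ, mul_one], fun w hw => ?_⟩
  rw [real_inner_smul_left, inner_sub_right]
  refine (h2 _ (hmem w hw)).trans ?_
  have : |inner ℝ ξ (w - u)| ≤ ‖w - u‖ := by simpa [hξ] using abs_real_inner_le_norm ξ (w - u)
  rw [inner_sub_right] at this
  rw [← sq_abs]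
  gcongr

/-- Here `d` is a chord length, `a` the first-order change of the radial function and `b` its
quadratic remainder. The terms linear in `a` cancel, and `-d ^ 2 / 2` absorbs what remains because
`κ` is small. -/
theorem perturbation_supporting_inequality {a b d κ : ℝ} (hd : 0 ≤ d) (hd2 : d ≤ 2)
    (hκ : κ ≤ 1 / 16) (hκ0 : 0 ≤ κ) (ha : |a| ≤ κ * d) (hb : |b| ≤ κ * d ^ 2) :
    (1 + a + b) * (1 - d ^ 2 / 2 - a) ≤ 1 := by
  have e : (1 + a + b) * (1 - d ^ 2 / 2 - a)
      = 1 - d ^ 2 / 2 - a * d ^ 2 / 2 - a ^ 2 + b * (1 - d ^ 2 / 2 - a) := by ring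
  have h1 : |a| ≤ 1 / 8 := by nlinarith
  have h2 : |1 - d ^ 2 / 2 - a| ≤ 2 := by
    rw [abs_le] at *
    constructor <;> nlinarith
  have h3 : b * (1 - d ^ 2 / 2 - a) ≤ κ * d ^ 2 * 2 := by
    refine (le_abs_self _).trans ?_
    rw [abs_mul]
    exact mul_le_mul hb h2 (abs_nonneg _) (by positivity)
  have h4 : -(a * d ^ 2 / 2) ≤ 1 / 16 * d ^ 2 := by
    have := (abs_le.1 h1).1
    nlinarith [sq_nonneg d]
  have h5 : κ * d ^ 2 * 2 ≤ 1 / 8 * d ^ 2 := by nlinarith [sq_nonneg d]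
  rw [e]
  nlinarith [sq_nonneg a, sq_nonneg d]

/-- Small `C^{1,1}` perturbations of the ball are convex bodies. -/
theorem SphereC11.isConvexBody {n : ℕ} [NeZero n] {h : E n → ℝ} (hh : SphereC11 h)
    (hnn : ∀ u, ‖u‖ = 1 → 0 ≤ h u) :
    ∃ ε₀ : ℝ, 0 < ε₀ ∧ ∀ ε, 0 < ε → ε < ε₀ →
      IsConvexBody (bodyOfRadial fun u => 1 + ε * h u) := by
  obtain ⟨C, hC, hC11⟩ := hh
  refine ⟨1 / (32 * (C + 1)), by positivity, fun ε hε hε0 => ?_⟩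
  have hεC : ε * (2 * C) ≤ 1 / 16 := by
    rw [lt_div_iff₀ (by positivity)] at hε0
    nlinarith
  have hge : ∀ u : E n, ‖u‖ = 1 → 1 ≤ 1 + ε * h u := fun u hu => by
    have := mul_nonneg hε.le (hnn u hu); linarith
  refine isConvexBody_bodyOfRadial hge (R := 1 + ε * C) (fun u hu => ?_) fun u hu => ?_
  · have := (le_abs_self _).trans (hC11 u hu).1
    gcongr
  obtain ⟨-, t, ht, htw⟩ := hC11 u hu
  set r : ℝ := 1 + ε * h u with hr
  have hr1 : 1 ≤ r := hge u hu
  have hr0 : 0 < r := by linarith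
  -- The tangential part of the gradient. The supporting normal at `u` is `u` tilted by `-(ε / r) •
  -- s`, scaled so that the supporting hyperplane is at level `1`.
  set s : E n := t - (inner ℝ t u : ℝ) • u with hs
  have hsu : inner ℝ s u = 0 := by
    rw [hs, inner_sub_left, real_inner_smul_left, inner_self_of_norm_one hu]; ring
  refine ⟨r⁻¹ • (u - (ε / r) • s), ?_, fun w hw => ?_⟩
  · rw [real_inner_smul_left, inner_sub_left, real_inner_smul_left, hsu,
      inner_self_of_norm_one hu]
    field_simp
    ring
  set d : ℝ := ‖w - u‖ with hd
  have hd2 : d ^ 2 = 2 - 2 * inner ℝ u w := by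
    rw [hd, norm_sub_sq_of_norm_one hw hu, real_inner_comm]
  have htu : |inner ℝ t u| ≤ C := by
    have := abs_real_inner_le_norm t u
    rw [hu, mul_one] at this
    exact this.trans ht
  have hsn : ‖s‖ ≤ 2 * C := by
    refine (norm_sub_le _ _).trans ?_
    rw [norm_smul, hu, Real.norm_eq_abs]; linarith
  have hsw : |inner ℝ s w| ≤ 2 * C * d := by
    have e : inner ℝ s w = inner ℝ s (w - u) := by rw [inner_sub_right, hsu, sub_zero]
    rw [e]
    exact (abs_real_inner_le_norm _ _).trans (mul_le_mul_of_nonneg_right hsn (norm_nonneg _))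
  -- Dropping the radial part of `t` costs only a quadratic term, since `u · (w - u) = -d ^ 2 / 2`.
  have hrem : |h w - h u - inner ℝ s w| ≤ 2 * C * d ^ 2 := by
    have e : h w - h u - inner ℝ s w
        = (h w - h u - inner ℝ t (w - u)) - inner ℝ t u * (d ^ 2 / 2) := by
      rw [hs, inner_sub_left, real_inner_smul_left, inner_sub_right, hd2]; ring
    rw [e]
    refine (abs_sub _ _).trans ?_
    rw [abs_mul, abs_of_nonneg (by positivity : (0 : ℝ) ≤ d ^ 2 / 2)]
    have := htw w hw
    have h2 : |inner ℝ t u| * (d ^ 2 / 2) ≤ C * (d ^ 2 / 2) := by gcongr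
    nlinarith [sq_nonneg d]
  have hε' : ε / r ≤ ε := div_le_self hε.le hr1
  have hε'0 : 0 ≤ ε / r := by positivity
  have hκ : ε / r * (2 * C) ≤ 1 / 16 := le_trans (by gcongr) hεC
  have main := perturbation_supporting_inequality (a := ε / r * inner ℝ s w)
    (b := ε / r * (h w - h u - inner ℝ s w)) (d := d) (κ := ε / r * (2 * C)) (norm_nonneg _)
    (by
      refine (norm_sub_le _ _).trans ?_
      rw [hw, hu]; norm_num)
    hκ (by positivity)
    (by rw [abs_mul, abs_of_nonneg hε'0, mul_assoc]; gcongr)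
    (by rw [abs_mul, abs_of_nonneg hε'0, mul_assoc]; gcongr)
  refine le_trans (le_of_eq ?_) main
  rw [real_inner_smul_left, inner_sub_left, real_inner_smul_left]
  have e1 : 1 - d ^ 2 / 2 - ε / r * inner ℝ s w = inner ℝ u w - ε / r * inner ℝ s w := by
    rw [hd2]; ring
  have e2 : 1 + ε / r * inner ℝ s w + ε / r * (h w - h u - inner ℝ s w) = (1 + ε * h w) * r⁻¹ := by
    field_simp
    rw [hr]; ring
  rw [e1, e2, mul_assoc]

/-! ### Bumps -/

theorem inner_mem_Icc_of_norm_one {n : ℕ} {a b : E n} (ha : ‖a‖ = 1) (hb : ‖b‖ = 1) :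
    inner ℝ a b ∈ Set.Icc (-1 : ℝ) 1 :=
  abs_le.1 (by simpa [ha, hb] using abs_real_inner_le_norm a b)

namespace IsBumpProfile

variable {δ : ℝ} {f : ℝ → ℝ}

theorem nonneg (hf : IsBumpProfile δ f) {t : ℝ} (ht : t ∈ Set.Icc (-1 : ℝ) 1) : 0 ≤ f t := by
  have h := hf.support (-1) (Real.neg_one_le_cos δ)
  rw [← h]
  exact hf.mono ⟨le_rfl, by norm_num⟩ ht ht.1

theorem le_one (hf : IsBumpProfile δ f) {t : ℝ} (ht : t ∈ Set.Icc (-1 : ℝ) 1) : f t ≤ 1 := by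
  rw [← hf.height]
  exact hf.mono ht ⟨by norm_num, le_rfl⟩ ht.2

theorem bump_nonneg {n : ℕ} (hf : IsBumpProfile δ f) {ξ u : E n} (hξ : ‖ξ‖ = 1) (hu : ‖u‖ = 1) :
    0 ≤ bump f ξ u :=
  hf.nonneg (inner_mem_Icc_of_norm_one hξ hu)

theorem bump_le_one {n : ℕ} (hf : IsBumpProfile δ f) {ξ u : E n} (hξ : ‖ξ‖ = 1) (hu : ‖u‖ = 1) :
    bump f ξ u ≤ 1 :=
  hf.le_one (inner_mem_Icc_of_norm_one hξ hu)

theorem bump_self {n : ℕ} (hf : IsBumpProfile δ f) {ξ : E n} (hξ : ‖ξ‖ = 1) : bump f ξ ξ = 1 := by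
  rw [bump, inner_self_of_norm_one hξ, hf.height]

/-- A chord is at most its angle, so supports given by angles can be handled with the triangle
inequality for norms. -/
theorem norm_sub_lt {n : ℕ} (hf : IsBumpProfile δ f) (hδ : 0 < δ) {ξ u : E n} (hξ : ‖ξ‖ = 1)
    (hu : ‖u‖ = 1) (h : bump f ξ u ≠ 0) : ‖u - ξ‖ < δ := by
  have h1 : Real.cos δ < inner ℝ ξ u := by
    by_contra hle
    exact h (hf.support _ (not_lt.1 hle))
  have h2 := Real.one_sub_sq_div_two_le_cos (x := δ)
  have h3 := norm_sub_sq_of_norm_one hu hξ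
  rw [real_inner_comm] at h3
  exact (sq_lt_sq₀ (norm_nonneg _) hδ.le).1 (by linarith)

theorem cos_nonneg_of_le_one (hδ : 0 < δ) (hδ1 : δ ≤ 1) : 0 ≤ Real.cos δ :=
  Real.cos_nonneg_of_neg_pi_div_two_le_of_le (by linarith [Real.pi_pos])
    (by linarith [Real.pi_gt_three])

theorem bddAbove_equator {n : ℕ} (hf : IsBumpProfile δ f) (p : E n) {u : E n} (hu : ‖u‖ = 1) :
    BddAbove (Set.range fun e : {e : E n // ‖e‖ = 1 ∧ inner ℝ e p = 0} => bump f e.1 u) :=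
  ⟨1, by rintro _ ⟨e, rfl⟩; exact hf.bump_le_one e.2.1 hu⟩

theorem bump_le_equatorBump {n : ℕ} (hf : IsBumpProfile δ f) {p u e : E n} (hu : ‖u‖ = 1)
    (he : ‖e‖ = 1) (hep : inner ℝ e p = 0) : bump f e u ≤ equatorBump f p u :=
  le_ciSup (hf.bddAbove_equator p hu) ⟨e, he, hep⟩

theorem equatorBump_nonneg {n : ℕ} (hf : IsBumpProfile δ f) {p u : E n} (hu : ‖u‖ = 1) :
    0 ≤ equatorBump f p u :=
  Real.iSup_nonneg fun e => hf.bump_nonneg e.2.1 hu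

theorem exists_bump_ne_zero_of_equatorBump {n : ℕ} {p u : E n} (h : equatorBump f p u ≠ 0) :
    ∃ e : E n, ‖e‖ = 1 ∧ inner ℝ e p = 0 ∧ bump f e u ≠ 0 := by
  by_contra hne
  push Not at hne
  refine h ?_
  have : (fun e : {e : E n // ‖e‖ = 1 ∧ inner ℝ e p = 0} => bump f e.1 u) = fun _ => 0 :=
    funext fun e => hne e.1 e.2.1 e.2.2
  rw [equatorBump, this]
  exact Real.iSup_const_zero

/-- The equator point nearest to `u` is the normalised projection of `u` on `p^⊥`, and monotonicity
of `f` makes its bump the largest. This turns the supremum into a function of the height alone, so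
its regularity can be checked in one variable. -/
theorem equatorBump_eq {n : ℕ} (hf : IsBumpProfile δ f) (hc : 0 ≤ Real.cos δ)
    {p u : E n} (hp : ‖p‖ = 1) (hu : ‖u‖ = 1) :
    equatorBump f p u = f (√(1 - (inner ℝ p u : ℝ) ^ 2)) := by
  set s : ℝ := inner ℝ p u with hs
  set w : E n := u - s • p with hw
  have hw2 : ‖w‖ ^ 2 = 1 - s ^ 2 := by
    rw [hw, norm_sub_sq_real, norm_smul, hp, hu, real_inner_smul_right, real_inner_comm, ← hs,
      mul_one, Real.norm_eq_abs, sq_abs]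
    ring
  have hwn : √(1 - s ^ 2) = ‖w‖ := by rw [← hw2, Real.sqrt_sq (norm_nonneg _)]
  have hw1 : ‖w‖ ≤ 1 := by
    have := norm_nonneg w
    nlinarith [sq_nonneg s]
  have hpw : inner ℝ p w = 0 := by
    rw [hw, inner_sub_right, real_inner_smul_right, inner_self_of_norm_one hp, ← hs]; ring
  rw [hwn]
  apply le_antisymm
  · refine Real.iSup_le (fun e => ?_) (hf.nonneg ⟨by linarith [norm_nonneg w], hw1⟩)
    have h1 : inner ℝ e.1 u = inner ℝ e.1 w := by
      rw [hw, inner_sub_right, real_inner_smul_right, e.2.2]; ring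
    refine hf.mono (inner_mem_Icc_of_norm_one e.2.1 hu) ⟨by linarith [norm_nonneg w], hw1⟩ ?_
    rw [h1]
    have := real_inner_le_norm e.1 w
    rwa [e.2.1, one_mul] at this
  -- At `u = ±p` there is no nearest equator point, but both sides vanish.
  · by_cases hw0 : w = 0
    · rw [hw0, norm_zero, hf.support 0 hc]
      exact hf.equatorBump_nonneg hu
    · have hwne : ‖w‖ ≠ 0 := norm_ne_zero_iff.2 hw0
      have h2 := hf.bump_le_equatorBump (p := p) (e := ‖w‖⁻¹ • w) hu
        (by rw [norm_smul, norm_inv, norm_norm, inv_mul_cancel₀ hwne])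
        (by rw [real_inner_smul_left, real_inner_comm, hpw, mul_zero])
      refine le_trans (le_of_eq ?_) h2
      have h3 : inner ℝ w u = ‖w‖ ^ 2 := by
        have : u = w + s • p := by rw [hw]; abel
        conv_lhs => rw [this]
        rw [inner_add_right, real_inner_smul_right, real_inner_comm p w, hpw,
          real_inner_self_eq_norm_sq]; ring
      rw [bump, real_inner_smul_left, h3]
      congr 1
      field_simp

/-- The square root is singular only where its argument is `0`, and near such points `f` is
evaluated below `cos δ`, where it vanishes. -/
theorem contDiff_comp_sqrt (hf : IsBumpProfile δ f) (hc : 0 < Real.cos δ) :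
    ContDiff ℝ 2 fun t : ℝ => f (√(1 - t ^ 2)) := by
  have hf2 : ContDiff ℝ 2 f := contDiff_infty.1 hf.smooth 2
  rw [contDiff_iff_contDiffAt]
  intro t
  by_cases ht : 1 - t ^ 2 = 0
  · have hlt : √(1 - t ^ 2) < Real.cos δ := by rw [ht, Real.sqrt_zero]; exact hc
    have hev : (fun t : ℝ => f (√(1 - t ^ 2))) =ᶠ[nhds t] fun _ => 0 := by
      have hcont : ContinuousAt (fun t : ℝ => √(1 - t ^ 2)) t := by fun_prop
      filter_upwards [hcont.eventually_lt continuousAt_const hlt] with x hx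
      exact hf.support _ hx.le
    exact contDiffAt_const.congr_of_eventuallyEq hev
  · exact hf2.contDiffAt.comp t
      (ContDiffAt.sqrt (by fun_prop) ht)

theorem sphereC11_bump {n : ℕ} (hf : IsBumpProfile δ f) {ξ : E n} (hξ : ‖ξ‖ = 1) :
    SphereC11 (bump f ξ) :=
  sphereC11_comp_inner (contDiff_infty.1 hf.smooth 2) hξ

theorem sphereC11_equatorBump {n : ℕ} (hf : IsBumpProfile δ f)
    (hc : 0 < Real.cos δ) {p : E n} (hp : ‖p‖ = 1) : SphereC11 (equatorBump f p) :=
  (sphereC11_comp_inner (hf.contDiff_comp_sqrt hc) hp).congr fun _ hu =>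
    hf.equatorBump_eq hc.le hp hu

end IsBumpProfile

theorem isBumpProfile_smoothTransition {d a : ℝ} (hd : Real.cos d < 1) (ha : 1 ≤ a) :
    IsBumpProfile d fun t => Real.smoothTransition (a * ((t - Real.cos d) / (1 - Real.cos d))) where
  smooth := Real.smoothTransition.contDiff.comp (by fun_prop)
  support t ht := Real.smoothTransition.zero_of_nonpos
    (mul_nonpos_of_nonneg_of_nonpos (by linarith)
      (div_nonpos_of_nonpos_of_nonneg (by linarith) (by linarith)))
  height := by
    have : (1 - Real.cos d) / (1 - Real.cos d) = 1 := div_self (by linarith)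
    simpa [this] using ha
  mono := by
    intro x _ y _ hxy
    apply Real.smoothTransition.monotone
    have : 0 < 1 - Real.cos d := by linarith
    gcongr

/-- Slope factor `2` makes the profile reach `1` at the midpoint of `cos d` and `1`, and `cos (d /
2)` is not below that midpoint by the double-angle formula. -/
theorem exists_bumpProfile {d : ℝ} (hd : 0 < d) (hd1 : d ≤ 1) :
    ∃ g, IsBumpProfile d g ∧ g (Real.cos (d / 2)) = 1 := by
  have hpi := Real.pi_gt_three
  have hlt : Real.cos d < 1 := by
    rw [← Real.cos_zero]
    exact Real.cos_lt_cos_of_nonneg_of_le_pi le_rfl (by linarith) hd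
  refine ⟨_, isBumpProfile_smoothTransition hlt one_le_two, ?_⟩
  apply Real.smoothTransition.one_of_one_le
  have h1 : Real.cos d = 2 * Real.cos (d / 2) ^ 2 - 1 := by
    rw [← Real.cos_two_mul]; ring_nf
  have h2 : 0 ≤ Real.cos (d / 2) :=
    Real.cos_nonneg_of_neg_pi_div_two_le_of_le (by linarith) (by linarith)
  have h3 := Real.cos_le_one (d / 2)
  rw [← mul_div_assoc, le_div_iff₀ (by linarith)]
  nlinarith [mul_nonneg h2 (sub_nonneg.2 h3)]

/-! ### Regular simplices -/

theorem cos_le_one_sub_sq_div_four {v : ℝ} (hv : 0 < v) (hv1 : v ≤ 1) :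
    Real.cos v ≤ 1 - v ^ 2 / 4 := by
  have h := (abs_le.1 (Real.cos_bound (x := v) (by rwa [abs_of_pos hv]))).2
  rw [abs_of_pos hv] at h
  have : v ^ 4 ≤ v ^ 2 := pow_le_pow_of_le_one hv.le hv1 (by norm_num)
  nlinarith [sq_nonneg v]

namespace IsRegularSimplex

variable {n : ℕ} {v : ℝ} {ξ : Fin n → E n}

theorem inner_eq (h : IsRegularSimplex v ξ) (i j : Fin n) :
    inner ℝ (ξ i) (ξ j) = Real.cos v + if i = j then 1 - Real.cos v else 0 := by
  split_ifs with hij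
  · rw [hij, inner_self_of_norm_one (h.norm_eq j)]; ring
  · rw [← InnerProductGeometry.cos_angle_mul_norm_mul_norm, h.dist_eq i j hij, h.norm_eq,
      h.norm_eq]; ring

theorem norm_sub_sq (h : IsRegularSimplex v ξ) {i j : Fin n} (hij : i ≠ j) :
    ‖ξ i - ξ j‖ ^ 2 = 2 - 2 * Real.cos v := by
  rw [norm_sub_sq_of_norm_one (h.norm_eq i) (h.norm_eq j), h.inner_eq, if_neg hij, add_zero]

theorem norm_sub_le (h : IsRegularSimplex v ξ) (hv : 0 < v) (i j : Fin n) : ‖ξ i - ξ j‖ ≤ v := by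
  rcases eq_or_ne i j with rfl | hij
  · simpa using hv.le
  · have h1 := h.norm_sub_sq hij
    have h2 := Real.one_sub_sq_div_two_le_cos (x := v)
    exact (sq_le_sq₀ (norm_nonneg _) hv.le).1 (by linarith)

theorem lt_norm_sub (h : IsRegularSimplex v ξ) (hv : 0 < v) (hv1 : v ≤ 1) {i j : Fin n}
    (hij : i ≠ j) : v / 2 < ‖ξ i - ξ j‖ := by
  have h1 := h.norm_sub_sq hij
  have h2 := cos_le_one_sub_sq_div_four hv hv1
  have h3 : 0 < v ^ 2 := by positivity
  exact (sq_lt_sq₀ (by positivity) (norm_nonneg _)).1 (by rw [h1]; nlinarith)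

theorem map (h : IsRegularSimplex v ξ) (Ψ : E n ≃ₗᵢ[ℝ] E n) :
    IsRegularSimplex v fun i => Ψ (ξ i) where
  norm_eq i := by rw [Ψ.norm_map, h.norm_eq]
  dist_eq i j hij := by
    rw [← h.dist_eq i j hij]; exact Ψ.toLinearIsometry.angle_map _ _

/-- The Gram matrix is `1 - cos v` times the identity plus `cos v` times the all-ones matrix, and
the second summand is positive semidefinite. -/
theorem sum_sq_le_norm_sq (h : IsRegularSimplex v ξ) (hc : 0 ≤ Real.cos v) (I : Finset (Fin n))
    (c : Fin n → ℝ) :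
    (1 - Real.cos v) * ∑ i ∈ I, c i ^ 2 ≤ ‖∑ i ∈ I, c i • ξ i‖ ^ 2 := by
  have e : ‖∑ i ∈ I, c i • ξ i‖ ^ 2
      = Real.cos v * (∑ i ∈ I, c i) ^ 2 + (1 - Real.cos v) * ∑ i ∈ I, c i ^ 2 := by
    rw [← real_inner_self_eq_norm_sq, sum_inner]
    simp_rw [inner_sum, real_inner_smul_left, real_inner_smul_right, h.inner_eq, mul_add,
      Finset.sum_add_distrib]
    congr 1
    · rw [sq, Finset.sum_mul_sum, Finset.mul_sum]
      refine Finset.sum_congr rfl fun i _ => ?_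
      rw [Finset.mul_sum]
      exact Finset.sum_congr rfl fun j _ => by ring
    · rw [Finset.mul_sum]
      refine Finset.sum_congr rfl fun i hi => ?_
      rw [Finset.sum_eq_single i]
      · rw [if_pos rfl]; ring
      · intro j _ hj
        rw [if_neg hj.symm]; ring
      · exact fun hni => absurd hi hni
  rw [e]
  have := mul_nonneg hc (sq_nonneg (∑ i ∈ I, c i))
  linarith

/-- Quantitative independence: a vector of the span that is almost orthogonal to the spanning
vertices is short. Expand `‖x‖ ^ 2` in the coefficients of `x`, apply Cauchy–Schwarz, and bound the
coefficients by the Gram estimate. -/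
theorem norm_sq_le_of_mem_span (h : IsRegularSimplex v ξ) (hv : 0 < v) (hv1 : v ≤ 1)
    {I : Finset (Fin n)} {x : E n} (hx : x ∈ Submodule.span ℝ (ξ '' I)) {η : ℝ}
    (hη : ∀ i ∈ I, |inner ℝ x (ξ i)| ≤ η) : v ^ 2 / 4 * ‖x‖ ^ 2 ≤ n * η ^ 2 := by
  obtain ⟨c, hcx⟩ := (Submodule.mem_span_image_finset_iff_exists_fun' ℝ).1 hx
  have h1 := h.sum_sq_le_norm_sq (IsBumpProfile.cos_nonneg_of_le_one hv hv1) I c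
  rw [hcx] at h1
  have h2 := cos_le_one_sub_sq_div_four hv hv1
  have h3 : ‖x‖ ^ 2 = ∑ i ∈ I, c i * inner ℝ x (ξ i) := by
    rw [← real_inner_self_eq_norm_sq]
    conv_lhs => rw [← hcx]
    rw [sum_inner]
    refine Finset.sum_congr rfl fun i _ => ?_
    rw [hcx, real_inner_smul_left, real_inner_comm]
  have h4 := Finset.sum_mul_sq_le_sq_mul_sq I c fun i => inner ℝ x (ξ i)
  rw [← h3] at h4
  have h5 : ∑ i ∈ I, (inner ℝ x (ξ i) : ℝ) ^ 2 ≤ n * η ^ 2 := by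
    refine (Finset.sum_le_card_nsmul I _ (η ^ 2) fun i hi => ?_).trans ?_
    · rw [← sq_abs]
      have := hη i hi
      gcongr
    · rw [nsmul_eq_mul]
      have : I.card ≤ n := by simpa using I.card_le_univ
      gcongr
  have hS : 0 ≤ ∑ i ∈ I, c i ^ 2 := Finset.sum_nonneg fun i _ => sq_nonneg _
  have h6 : v ^ 2 / 4 * ∑ i ∈ I, c i ^ 2 ≤ ‖x‖ ^ 2 := by nlinarith
  rcases (sq_nonneg ‖x‖).eq_or_lt with h0 | hpos
  · rw [← h0, mul_zero]; positivity
  · have h7 : v ^ 2 / 4 * (‖x‖ ^ 2) ^ 2 ≤ ‖x‖ ^ 2 * (n * η ^ 2) := by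
      calc v ^ 2 / 4 * (‖x‖ ^ 2) ^ 2
          ≤ v ^ 2 / 4 * ((∑ i ∈ I, c i ^ 2) * ∑ i ∈ I, (inner ℝ x (ξ i) : ℝ) ^ 2) := by gcongr
        _ = (v ^ 2 / 4 * ∑ i ∈ I, c i ^ 2) * ∑ i ∈ I, (inner ℝ x (ξ i) : ℝ) ^ 2 := by ring
        _ ≤ _ := by
          refine mul_le_mul h6 h5 (Finset.sum_nonneg fun i _ => sq_nonneg _) (sq_nonneg _)
    refine le_of_mul_le_mul_left ?_ hpos
    linarith

theorem span_eq_top [NeZero n] (h : IsRegularSimplex v ξ) (hv : 0 < v) (hv1 : v ≤ 1) :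
    Submodule.span ℝ (Set.range ξ) = ⊤ := by
  refine LinearIndependent.span_eq_top_of_card_eq_finrank ?_ (by simp)
  rw [Fintype.linearIndependent_iff]
  intro c hc i
  have h1 := h.sum_sq_le_norm_sq (IsBumpProfile.cos_nonneg_of_le_one hv hv1) Finset.univ c
  have h2 := cos_le_one_sub_sq_div_four hv hv1
  rw [hc, norm_zero] at h1
  have h3 := Finset.single_le_sum (f := fun i => c i ^ 2) (fun i _ => sq_nonneg (c i))
    (Finset.mem_univ i)
  have h4 : 0 < v ^ 2 := by positivity
  have h5 : c i ^ 2 = 0 := by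
    apply le_antisymm _ (sq_nonneg _)
    by_contra hne
    nlinarith
  simpa using h5

theorem natCast_mul_le {v : ℝ} (hv : 0 < v) (hvn : v < 1 / 4 ^ n / 10 ^ 3) :
    (n : ℝ) * v ≤ 1 / 10 ^ 3 := by
  have h1 : (n : ℝ) ≤ 4 ^ n := by exact_mod_cast (Nat.lt_pow_self (by norm_num)).le
  rw [div_div, lt_div_iff₀ (by positivity)] at hvn
  nlinarith

/-- No hyperplane comes close to all vertices of a regular simplex. -/
theorem exists_lt_abs_inner [NeZero n] (h : IsRegularSimplex v ξ) (hv : 0 < v)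
    (hvn : v < 1 / 4 ^ n / 10 ^ 3) {x : E n} (hx : ‖x‖ = 1) :
    ∃ i, v ^ 4 < |inner ℝ x (ξ i)| := by
  by_contra! hcon
  have hn1 : (1 : ℝ) ≤ n := by exact_mod_cast NeZero.one_le
  have h0 := natCast_mul_le hv hvn
  have hv1 : v ≤ 1 / 1000 := by nlinarith
  have hmem : x ∈ Submodule.span ℝ (ξ '' (Finset.univ : Finset (Fin n))) := by
    rw [Finset.coe_univ, Set.image_univ, h.span_eq_top hv (by linarith)]; trivial
  have h1 := h.norm_sq_le_of_mem_span hv (by linarith) hmem (η := v ^ 4) fun i _ => hcon i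
  rw [hx] at h1
  have h2 : n * (v ^ 4) ^ 2 = v ^ 2 * (n * v * v ^ 5) := by ring
  have h3 : v ^ 5 ≤ 1 := pow_le_one₀ hv.le (by linarith)
  have h4 : 0 < v ^ 2 := by positivity
  have h5 : n * v * v ^ 5 ≤ 1 / 10 ^ 3 := by
    calc n * v * v ^ 5 ≤ n * v * 1 := by gcongr
      _ ≤ _ := by linarith
  rw [h2] at h1
  nlinarith

end IsRegularSimplex

theorem exists_isRegularSimplex (n : ℕ) [NeZero n] {v : ℝ} (hv : 0 < v) (hv1 : v ≤ 1) :
    ∃ ξ : Fin n → E n, IsRegularSimplex v ξ := by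
  set c := Real.cos v with hc
  have hc0 : 0 ≤ c := IsBumpProfile.cos_nonneg_of_le_one hv hv1
  have hc1 : c ≤ 1 := Real.cos_le_one v
  have hn : (n : ℝ) ≠ 0 := by exact_mod_cast NeZero.ne n
  set a := √(1 - c) with ha
  have ha2 : a ^ 2 = 1 - c := Real.sq_sqrt (by linarith)
  -- The vertices are `a • e i + b • s`, with `s` the sum of the basis; `b` is the root of `n * b ^
  -- 2 + 2 * a * b = c` that gives inner products `c`.
  set b := (√(a ^ 2 + n * c) - a) / n with hb
  have hb2 : (n * b + a) ^ 2 = a ^ 2 + n * c := by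
    have : n * b + a = √(a ^ 2 + n * c) := by rw [hb]; field_simp; ring
    rw [this, Real.sq_sqrt (by positivity)]
  have hb3 : 2 * a * b + n * b ^ 2 = c := by
    apply mul_left_cancel₀ hn
    linarith
  let e : Fin n → E n := fun i => EuclideanSpace.single i 1
  let s : E n := ∑ i, e i
  have hee : ∀ i j, inner ℝ (e i) (e j) = if i = j then (1 : ℝ) else 0 := fun i j => by
    simp only [e]
    rw [EuclideanSpace.inner_single_left]
    simp
  have hes : ∀ i, inner ℝ (e i) s = (1 : ℝ) := fun i => by
    rw [inner_sum]; simp [hee]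
  have hss : inner ℝ s s = (n : ℝ) := by
    rw [sum_inner]; simp [hes]
  have hin : ∀ i j, inner ℝ (a • e i + b • s) (a • e j + b • s)
      = if i = j then (1 : ℝ) else c := fun i j => by
    simp only [inner_add_left, inner_add_right, real_inner_smul_left, real_inner_smul_right, hee,
      hes, hss, real_inner_comm _ s]
    split_ifs <;> linarith
  have hnorm : ∀ i, ‖a • e i + b • s‖ = 1 := fun i => by
    have h1 := hin i i
    rw [if_pos rfl, real_inner_self_eq_norm_sq] at h1
    nlinarith [norm_nonneg (a • e i + b • s)]
  refine ⟨fun i => a • e i + b • s, hnorm, fun i j hij => ?_⟩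
  rw [InnerProductGeometry.angle, hnorm, hnorm, hin, if_neg hij, mul_one, div_one, hc,
    Real.arccos_cos hv.le (by linarith [Real.pi_gt_three])]

/-! ### Layered placements -/

/-- Removing the pole injects the sub-configurations into the non-empty subsets of the other `n - 1`
vertices. There are exactly `2 ^ (n - 1) - 1` even layers below the top, so the layers suffice. -/
theorem card_subConfigs_le (n : ℕ) [NeZero n] : (subConfigs n).card + 1 ≤ 2 ^ (n - 1) := by
  have h1 : (subConfigs n).card ≤ ((Finset.univ.erase (0 : Fin n)).powerset.erase ∅).card := by
    refine Finset.card_le_card_of_injOn (fun I => I.erase 0) (fun I hI => ?_) ?_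
    · obtain ⟨h0, h2, -⟩ := (Finset.mem_filter.1 hI).2
      simp only [Finset.coe_erase, Set.mem_sdiff, Finset.mem_coe, Finset.mem_powerset,
        Set.mem_singleton_iff]
      refine ⟨Finset.erase_subset_erase _ (Finset.subset_univ I), fun h => ?_⟩
      have := Finset.card_erase_of_mem h0
      rw [h, Finset.card_empty] at this
      omega
    · intro I hI J hJ h
      have hI0 := (Finset.mem_filter.1 hI).2.1
      have hJ0 := (Finset.mem_filter.1 hJ).2.1
      rw [← Finset.insert_erase hI0, ← Finset.insert_erase hJ0]
      exact congrArg _ h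
  rw [Finset.card_erase_of_mem (Finset.empty_mem_powerset _), Finset.card_powerset,
    Finset.card_erase_of_mem (Finset.mem_univ _), Finset.card_univ, Fintype.card_fin] at h1
  have : 1 ≤ 2 ^ (n - 1) := Nat.one_le_two_pow
  omega

theorem exists_layer_index (n : ℕ) [NeZero n] : ∃ k : Finset (Fin n) → ℕ,
    (∀ I ∈ subConfigs n, Even (k I) ∧ 1 ≤ k I ∧ k I < 2 ^ n) ∧ Set.InjOn k (subConfigs n) := by
  classical
  let k : Finset (Fin n) → ℕ := fun I =>
    if h : I ∈ subConfigs n then 2 * ((subConfigs n).equivFin ⟨I, h⟩ + 1) else 0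
  refine ⟨k, fun I hI => ?_, fun I hI J hJ hIJ => ?_⟩
  · have h1 := ((subConfigs n).equivFin ⟨I, hI⟩).2
    have h2 := card_subConfigs_le n
    have h3 : 2 ^ n = 2 * 2 ^ (n - 1) := by
      rw [← pow_succ', Nat.sub_add_cancel NeZero.one_le]
    simp only [k, dif_pos hI]
    exact ⟨even_two_mul _, by omega, by omega⟩
  · simp only [k, dif_pos (show I ∈ subConfigs n from hI),
      dif_pos (show J ∈ subConfigs n from hJ)] at hIJ
    have h1 : (subConfigs n).equivFin ⟨I, hI⟩ = (subConfigs n).equivFin ⟨J, hJ⟩ :=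
      Fin.ext (by omega)
    exact congrArg Subtype.val ((subConfigs n).equivFin.injective h1)

theorem norm_sub_le_of_angle_le {n : ℕ} {a b : E n} (ha : ‖a‖ = 1) (hb : ‖b‖ = 1) {d : ℝ}
    (h : InnerProductGeometry.angle a b ≤ d) : ‖b - a‖ ≤ d := by
  have h0 := InnerProductGeometry.angle_nonneg a b
  have h1 := norm_sub_sq_of_norm_one hb ha
  have h2 := Real.one_sub_sq_div_two_le_cos (x := InnerProductGeometry.angle a b)
  rw [InnerProductGeometry.cos_angle, ha, hb, mul_one, div_one, ← real_inner_comm] at h2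
  exact ((sq_le_sq₀ (norm_nonneg _) h0).1 (by linarith)).trans h

theorem lt_one_div_two_pow {n : ℕ} {v : ℝ} (hvn : v < 1 / 4 ^ n / 10 ^ 3) :
    v < 1 / 2 ^ n / 10 ^ 3 := by
  refine hvn.trans_le ?_
  gcongr
  norm_num

theorem exists_rotation_into_layer {n : ℕ} [NeZero n] {v : ℝ} (hv : 0 < v)
    (hvn : v < 1 / 4 ^ n / 10 ^ 3) {ξ : Fin n → E n} (hξ : IsRegularSimplex v ξ)
    {I : Finset (Fin n)} (hI : I ∈ subConfigs n) {k : ℕ} (hk1 : 1 ≤ k) (hk2 : k < 2 ^ n) :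
    ∃ R : E n ≃ₗᵢ[ℝ] E n, IsRotation R ∧ (∀ x ∈ (Submodule.span ℝ (ξ '' I))ᗮ, R x = x) ∧
      ∀ i ∈ I, ∀ u : E n, ‖u‖ = 1 → InnerProductGeometry.angle (R (ξ i)) u ≤ v ^ 2 →
        u ∈ layer (ξ 0) k := by
  have hv2 := lt_one_div_two_pow hvn
  set t : ℝ := 1 / 2 ^ n with ht
  have ht0 : 0 < t := by positivity
  have ht1 : t ≤ 1 := by
    rw [ht]; exact div_le_one_of_le₀ (one_le_pow₀ (by norm_num)) (by positivity)
  obtain ⟨h0I, h2, -⟩ := (Finset.mem_filter.1 hI).2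
  obtain ⟨j, hjI, hj0⟩ := Finset.exists_mem_ne (by omega : 1 < I.card) 0
  set w : E n := ξ j - Real.cos v • ξ 0 with hw
  have h00 := inner_self_of_norm_one (hξ.norm_eq 0)
  have hw0 : inner ℝ (ξ 0) w = 0 := by
    rw [hw, inner_sub_right, real_inner_smul_right, h00, hξ.inner_eq, if_neg hj0.symm]; ring
  have hwne : w ≠ 0 := by
    intro h
    have h1 : ξ j = Real.cos v • ξ 0 := sub_eq_zero.1 h
    have h2 := inner_self_of_norm_one (hξ.norm_eq j)
    rw [h1, real_inner_smul_left, real_inner_smul_right, h00] at h2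
    have h3 := cos_le_one_sub_sq_div_four hv (by linarith)
    have h4 := IsBumpProfile.cos_nonneg_of_le_one hv (by linarith)
    nlinarith [sq_pos_of_pos hv]
  have hwn : ‖w‖ ≠ 0 := norm_ne_zero_iff.2 hwne
  -- The middle height of layer `k`. The pole is turned to this height in the plane of `ξ 0` and `ξ
  -- j`, which lies in the span of `I`; the other vertices and their disks stay within `v + v ^ 2`,
  -- less than half a layer.
  set h : ℝ := ((k : ℝ) - 1 / 2) * t with hh
  have hk1' : (1 : ℝ) ≤ k := by exact_mod_cast hk1
  have hkt : (k : ℝ) * t ≤ 1 := by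
    have : (k : ℝ) ≤ 2 ^ n := by exact_mod_cast hk2.le
    rw [ht, mul_one_div, div_le_one (by positivity)]; exact this
  have hh0 : 0 ≤ h := by rw [hh]; exact mul_nonneg (by linarith) ht0.le
  have hh1 : h ≤ 1 := by rw [hh]; nlinarith
  set p : E n := h • ξ 0 + (√(1 - h ^ 2) * ‖w‖⁻¹) • w with hp
  have hpin : inner ℝ (ξ 0) p = h := by
    rw [hp, inner_add_right, real_inner_smul_right, real_inner_smul_right, h00, hw0]; ring
  have hpn : ‖p‖ = 1 := by
    have e : ‖p‖ ^ 2 = 1 := by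
      rw [hp, norm_add_sq_real, real_inner_smul_left, real_inner_smul_right, hw0, norm_smul h,
        norm_smul (_ * _), hξ.norm_eq, norm_mul (√(1 - h ^ 2)), norm_inv, norm_norm, Real.norm_eq_abs, Real.norm_eq_abs,
        inv_mul_cancel_right₀ hwn, sq_abs, Real.sq_sqrt (by nlinarith), mul_one, sq_abs]
      ring
    nlinarith [norm_nonneg p]
  obtain ⟨R, hR, hRp, hRfix, -⟩ := exists_rotation_apply_eq (hξ.norm_eq 0) hpn (by rwa [hpin])
  refine ⟨R, hR, fun x hx => ?_, fun i hi u hu hang => ?_⟩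
  · have hmem : ∀ i ∈ I, inner ℝ (ξ i) x = 0 := fun i hi =>
      hx _ (Submodule.subset_span ⟨i, hi, rfl⟩)
    refine hRfix x (hmem 0 h0I) ?_
    rw [hp, hw, inner_add_left, real_inner_smul_left, real_inner_smul_left, inner_sub_left,
      real_inner_smul_left, hmem 0 h0I, hmem j hjI]
    ring
  · have hRi : ‖R (ξ i)‖ = 1 := by rw [R.norm_map, hξ.norm_eq]
    have h1 := norm_sub_le_of_angle_le hRi hu hang
    have h3 : ‖R (ξ i) - p‖ ≤ v := by
      rw [← hRp, ← map_sub, R.norm_map]; exact hξ.norm_sub_le hv i 0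
    have h4 : |inner ℝ (ξ 0) u - h| ≤ v ^ 2 + v := by
      rw [← hpin, ← inner_sub_right]
      have h5 := abs_real_inner_le_norm (ξ 0) (u - p)
      rw [hξ.norm_eq, one_mul] at h5
      have h6 := norm_add_le (u - R (ξ i)) (R (ξ i) - p)
      rw [sub_add_sub_cancel] at h6
      linarith
    have h7 : v ^ 2 + v ≤ t / 2 := by nlinarith
    obtain ⟨h8, h9⟩ := abs_le.1 h4
    refine ⟨hu, ?_, ?_⟩
    · have : ((k : ℝ) - 1) / 2 ^ n = h - t / 2 := by rw [hh, ht]; ring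
      rw [this]; linarith
    · have : (k : ℝ) / 2 ^ n = h + t / 2 := by rw [hh, ht]; ring
      rw [this]; linarith

theorem exists_isLayeredPlacement {n : ℕ} [NeZero n] {v : ℝ} (hv : 0 < v)
    (hvn : v < 1 / 4 ^ n / 10 ^ 3) {ξ : Fin n → E n} (hξ : IsRegularSimplex v ξ) :
    ∃ R k, IsLayeredPlacement v ξ R k := by
  obtain ⟨k, hk, hinj⟩ := exists_layer_index n
  choose! R hR using fun I (hI : I ∈ subConfigs n) =>
    exists_rotation_into_layer hv hvn hξ hI (hk I hI).2.1 (hk I hI).2.2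
  exact ⟨R, k, fun I hI => (hR I hI).1, fun I hI => (hR I hI).2.1, fun I hI => (hk I hI).1,
    fun I hI => (hk I hI).2, hinj, fun I hI => (hR I hI).2.2⟩

/-! ### Polarity -/

theorem isConvexBody_polarSet {n : ℕ} [NeZero n] {A : Set (E n)}
    (hball : Metric.closedBall 0 1 ⊆ A) (hA : Bornology.IsBounded A) :
    IsConvexBody (polarSet A) := by
  have heq : polarSet A = ⋂ y ∈ A, {x | inner ℝ y x ≤ 1} := by
    ext x
    simp only [Set.mem_iInter, Set.mem_ofPred_eq, polarSet, real_inner_comm x]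
  obtain ⟨R, hR, hAR⟩ := hA.subset_closedBall_lt 0 0
  refine isConvexBody_of_closedBall_subset (r := R⁻¹) (R := 1) ?_ ?_ (by positivity) ?_ ?_
  · rw [heq]
    exact isClosed_biInter fun u _ =>
      isClosed_le (continuous_const.inner continuous_id) continuous_const
  · rw [heq]
    exact convex_iInter₂ fun u _ => convex_halfSpace_le (innerSL ℝ u).isLinear 1
  · intro x hx y hy
    have h1 := mem_closedBall_zero_iff.1 hx
    have h2 := mem_closedBall_zero_iff.1 (hAR hy)
    calc inner ℝ x y ≤ ‖x‖ * ‖y‖ := real_inner_le_norm x y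
      _ ≤ R⁻¹ * R := by gcongr
      _ = 1 := inv_mul_cancel₀ hR.ne'
  · intro x hx
    obtain ⟨u, hu, hxu⟩ := exists_unit_smul x
    have h1 := hx u (hball (mem_closedBall_zero_iff.2 hu.le))
    rw [hxu, real_inner_smul_left, inner_self_of_norm_one hu, mul_one] at h1
    exact mem_closedBall_zero_iff.2 h1

/-- The bipolar theorem: a separating functional, normalised to level `1`, lies in the polar. -/
theorem mem_of_forall_mem_polarSet {n : ℕ} {A : Set (E n)} (hc : IsClosed A) (hconv : Convex ℝ A)
    (h0 : (0 : E n) ∈ A) {x : E n} (hx : ∀ y ∈ polarSet A, inner ℝ y x ≤ 1) : x ∈ A := by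
  by_contra hxA
  obtain ⟨φ, r, hφ, hr⟩ := geometric_hahn_banach_closed_point hconv hc hxA
  have hr0 : 0 < r := by simpa using hφ 0 h0
  set w := (InnerProductSpace.toDual ℝ (E n)).symm φ with hw
  have hwφ : ∀ y, inner ℝ w y = φ y := fun y => InnerProductSpace.toDual_symm_apply
  have h1 := hx (r⁻¹ • w) fun y hy => by
    rw [real_inner_smul_left, hwφ, inv_mul_le_one₀ hr0]
    exact (hφ y hy).le
  rw [real_inner_smul_left, hwφ, inv_mul_le_one₀ hr0] at h1
  linarith

theorem not_containsRotationOf_polarSet {n : ℕ} {K L : Set (E n)} (hc : IsClosed L)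
    (hconv : Convex ℝ L) (h0 : (0 : E n) ∈ L) (h : ¬ ContainsRotationOf L K) :
    ¬ ContainsRotationOf (polarSet K) (polarSet L) := by
  rintro ⟨Ψ, hΨ, hsub⟩
  refine h ⟨Ψ⁻¹, hΨ.inv, ?_⟩
  rintro _ ⟨x, hx, rfl⟩
  refine mem_of_forall_mem_polarSet hc hconv h0 fun y hy => ?_
  have h1 := hsub ⟨y, hy, rfl⟩ x hx
  rwa [← Ψ.apply_symm_apply x, Ψ.inner_map_map] at h1

/-- Polarity turns sections into projections: a functional on `ξ^⊥` that is at most `1` on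
`K ∩ ξ^⊥` extends to one that is at most `1` on `K`. -/
theorem exists_mem_polarSet_extending {n : ℕ} {K : Set (E n)} (hconv : Convex ℝ K)
    (hball : Metric.closedBall 0 1 ⊆ K) {ξ w : E n}
    (hw : ∀ y ∈ hyperplaneSection K ξ, inner ℝ w y ≤ 1) :
    ∃ x ∈ polarSet K, ∀ y, inner ℝ y ξ = 0 → inner ℝ x y = inner ℝ w y := by
  have habs : Absorbent ℝ K :=
    absorbent_nhds_zero (Filter.mem_of_superset (Metric.closedBall_mem_nhds 0 one_pos) hball)
  have hmem : ∀ y, y ∈ (ℝ ∙ ξ)ᗮ ↔ inner ℝ y ξ = 0 := fun y => by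
    rw [Submodule.mem_orthogonal_singleton_iff_inner_left]
  let f : E n →ₗ.[ℝ] ℝ :=
    { domain := (ℝ ∙ ξ)ᗮ
      toFun := (innerSL ℝ w : E n →ₗ[ℝ] ℝ).comp (ℝ ∙ ξ)ᗮ.subtype }
  have hf : ∀ y : f.domain, f y = inner ℝ w (y : E n) := fun y => rfl
  -- Hahn–Banach with the gauge of `K` as sublinear bound. On `ξ^⊥` the bound holds because a point
  -- of `K` proportional to `y` lies in the section.
  obtain ⟨g, hgf, hgN⟩ := exists_extension_of_le_sublinear f (gauge K)
    (fun c hc x => by rw [gauge_smul_of_nonneg hc.le, smul_eq_mul])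
    (fun x y => gauge_add_le hconv habs x y) (fun y => by
      rw [hf]
      refine le_of_forall_gt_imp_ge_of_dense fun a ha => ?_
      obtain ⟨b, hb, hba, z, hz, hzy⟩ := exists_lt_of_gauge_lt habs ha
      have hzy' : b • z = (y : E n) := hzy
      have h1 : inner ℝ z ξ = 0 := by
        have h2 := (hmem y).1 y.2
        rw [← hzy', real_inner_smul_left, mul_eq_zero] at h2
        exact h2.resolve_left hb.ne'
      rw [← hzy', real_inner_smul_right]
      have := hw z ⟨hz, h1⟩
      nlinarith)
  set x := (InnerProductSpace.toDual ℝ (E n)).symm (LinearMap.toContinuousLinearMap g)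
  have hx : ∀ y, inner ℝ x y = g y := fun y => InnerProductSpace.toDual_symm_apply
  refine ⟨x, fun y hy => ?_, fun y hy => ?_⟩
  · rw [hx]
    exact (hgN y).trans (gauge_le_one_of_mem hy)
  · rw [hx]
    exact hgf ⟨y, (hmem y).2 hy⟩

/-- Projecting a polar set gives the polar, inside `ξ^⊥`, of the section. Polarity reverses
inclusions, so the inverse rotation serves. -/
theorem SectionsRotateInto.polarSet {n : ℕ} {K L : Set (E n)} (hconv : Convex ℝ K)
    (hball : Metric.closedBall 0 1 ⊆ K) (h : SectionsRotateInto K L) :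
    ProjectionsRotateInto (polarSet L) (polarSet K) := by
  intro ξ hξ
  obtain ⟨Φ, hΦ, hΦξ, hsub⟩ := h ξ hξ
  have hΦξ' : Φ⁻¹ ξ = ξ := by
    conv_lhs => rw [← hΦξ]
    exact Φ.symm_apply_apply ξ
  refine ⟨Φ⁻¹, hΦ.inv, hΦξ', ?_⟩
  rintro _ ⟨_, ⟨x, hx, rfl⟩, rfl⟩
  set P := (ℝ ∙ ξ)ᗮ with hP
  have hmem : ∀ y, y ∈ P ↔ inner ℝ y ξ = 0 := fun y => by
    rw [hP, Submodule.mem_orthogonal_singleton_iff_inner_left]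
  have hproj : ∀ a y, y ∈ P → inner ℝ (P.starProjection a) y = inner ℝ a y := fun a y hy => by
    rw [Submodule.inner_starProjection_left_eq_right, Submodule.starProjection_eq_self_iff.2 hy]
  set w := Φ⁻¹ (P.starProjection x) with hw
  have hwP : w ∈ P := by
    have h1 : inner ℝ w (Φ⁻¹ ξ) = inner ℝ (P.starProjection x) ξ :=
      LinearIsometryEquiv.inner_map_map _ _ _
    rw [hΦξ', (hmem _).1 (Submodule.starProjection_apply_mem _ _)] at h1
    exact (hmem w).2 h1
  obtain ⟨z, hz, hzw⟩ := exists_mem_polarSet_extending hconv hball (ξ := ξ) (w := w) (by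
    intro y hy
    have h1 := hsub ⟨y, hy, rfl⟩
    have h2 : inner ℝ w y = inner ℝ (P.starProjection x) (Φ y) := by
      rw [← Φ.inner_map_map w y]
      congr 1
      exact Φ.apply_symm_apply _
    rw [h2, hproj _ _ ((hmem _).2 h1.2)]
    exact hx _ h1.1)
  refine ⟨z, hz, ?_⟩
  change P.starProjection z = w
  have hdP : P.starProjection z - w ∈ P := P.sub_mem (Submodule.starProjection_apply_mem _ _) hwP
  have h3 : inner ℝ (P.starProjection z - w) (P.starProjection z - w) = (0 : ℝ) := by
    conv_lhs => rw [inner_sub_left, hproj _ _ hdP, hzw _ ((hmem _).1 hdP), sub_self]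
  exact sub_eq_zero.1 (inner_self_eq_zero.1 h3)

/-! ### The radial functions of the two bodies -/

/-- The radial function of `bodyK`. -/
noncomputable def radialK {n : ℕ} (ε : ℝ) (f : ℝ → ℝ) (ξ : Fin n → E n) (u : E n) : ℝ :=
  1 + ∑ i, ε / 10 ^ 3 * bump f (ξ i) u

/-- The radial function of `bodyL`. -/
noncomputable def radialL {n : ℕ} [NeZero n] (ε : ℝ) (f g : ℝ → ℝ) (ξ : Fin n → E n)
    (R : Finset (Fin n) → (E n ≃ₗᵢ[ℝ] E n)) (u : E n) : ℝ :=
  1 + ∑ i ∈ Finset.univ.erase 0, ε / 10 ^ 3 * bump f (ξ i) u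
    + ∑ I ∈ subConfigs n, ∑ i ∈ I, ε * bump g (R I (ξ i)) u
    + ε / 10 ^ 3 * equatorBump f (ξ 0) u

/-- The ingredients of the construction. -/
structure IsBumpData {n : ℕ} [NeZero n] (v : ℝ) (ξ : Fin n → E n)
    (R : Finset (Fin n) → (E n ≃ₗᵢ[ℝ] E n)) (k : Finset (Fin n) → ℕ) (f g : ℝ → ℝ) : Prop where
  three_le : 3 ≤ n
  pos : 0 < v
  small : v < 1 / 4 ^ n / 10 ^ 3
  simplex : IsRegularSimplex v ξ
  placement : IsLayeredPlacement v ξ R k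
  profile_f : IsBumpProfile (v ^ 4) f
  profile_g : IsBumpProfile (v ^ 2) g
  half_height : 1 / 10 ^ 3 ≤ g (Real.cos (v ^ 2 / 2))

theorem exists_unit_orthogonal {n : ℕ} (hn : 3 ≤ n) (a b : E n) :
    ∃ e : E n, ‖e‖ = 1 ∧ inner ℝ a e = 0 ∧ inner ℝ b e = 0 := by
  set W : Submodule ℝ (E n) := Submodule.span ℝ {a, b} with hW
  have h1 : Module.finrank ℝ W ≤ 2 := by
    have := finrank_span_finset_le_card (R := ℝ) ({a, b} : Finset (E n))
    rw [Finset.coe_pair] at this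
    exact this.trans Finset.card_le_two
  have h2 := W.finrank_add_finrank_orthogonal
  rw [finrank_euclideanSpace_fin] at h2
  have h3 : Wᗮ ≠ ⊥ := by
    intro h
    rw [h, finrank_bot] at h2
    omega
  obtain ⟨x, hx, hx0⟩ := Submodule.exists_mem_ne_zero_of_ne_bot h3
  have ha : inner ℝ a x = 0 := hx a (Submodule.subset_span (by simp))
  have hb : inner ℝ b x = 0 := hx b (Submodule.subset_span (by simp))
  refine ⟨‖x‖⁻¹ • x, ?_, ?_, ?_⟩
  · rw [norm_smul, norm_inv, norm_norm, inv_mul_cancel₀ (norm_ne_zero_iff.2 hx0)]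
  · rw [real_inner_smul_right, ha, mul_zero]
  · rw [real_inner_smul_right, hb, mul_zero]

/-- Within `θ^⊥`, a single bump can be rotated below the bump slid around the equator. -/
theorem IsBumpProfile.exists_rotation_le_equatorBump {n : ℕ} (hn : 3 ≤ n) {δ : ℝ} {f : ℝ → ℝ}
    (hf : IsBumpProfile δ f) (hc : 0 ≤ Real.cos δ) {p θ : E n} (hp : ‖p‖ = 1) (hθ : ‖θ‖ = 1) :
    ∃ Φ : E n ≃ₗᵢ[ℝ] E n, IsRotation Φ ∧ Φ θ = θ ∧
      ∀ u, ‖u‖ = 1 → inner ℝ u θ = 0 → bump f p u ≤ equatorBump f p (Φ u) := by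
  set s : ℝ := inner ℝ p θ with hs
  set P : E n := p - s • θ with hP
  have hpu : ∀ u : E n, inner ℝ u θ = 0 → inner ℝ p u = inner ℝ P u := fun u hu => by
    rw [hP, inner_sub_left, real_inner_smul_left, real_inner_comm u θ, hu]; ring
  by_cases hP0 : P = 0
  · refine ⟨1, isRotation_one, rfl, fun u hu huθ => ?_⟩
    have : bump f p u = 0 := by
      rw [bump, hpu u huθ, hP0, inner_zero_left]; exact hf.support 0 hc
    rw [this]
    exact hf.equatorBump_nonneg hu
  have hPne : ‖P‖ ≠ 0 := norm_ne_zero_iff.2 hP0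
  have hPθ : inner ℝ P θ = 0 := by
    rw [hP, inner_sub_left, real_inner_smul_left, inner_self_of_norm_one hθ, hs]; ring
  have hPle : ‖P‖ ≤ 1 := by
    have h1 : ‖P‖ ^ 2 = inner ℝ p P := by
      rw [← real_inner_self_eq_norm_sq, ← hpu P hPθ]
    have h2 := real_inner_le_norm p P
    rw [hp, one_mul] at h2
    nlinarith [norm_nonneg P]
  -- On `θ^⊥` the bump sees only the projection `P` of `p`. The target `e` must lie both on the
  -- equator and in `θ^⊥`, which needs `3 ≤ n`.
  obtain ⟨e, he, hpe, hθe⟩ := exists_unit_orthogonal hn p θ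
  have hPe : inner ℝ P e = 0 := by
    rw [← hpu e (by rw [real_inner_comm, hθe]), hpe]
  obtain ⟨Φ, hΦ, hΦe, hfix, -⟩ := exists_rotation_apply_eq (a := ‖P‖⁻¹ • P) (b := e)
    (by rw [norm_smul, norm_inv, norm_norm, inv_mul_cancel₀ hPne]) he
    (by rw [real_inner_smul_left, hPe, mul_zero])
  refine ⟨Φ, hΦ, hfix θ (by rw [real_inner_smul_left, hPθ, mul_zero])
    (by rw [real_inner_comm, hθe]), fun u hu huθ => ?_⟩
  have hΦu : ‖Φ u‖ = 1 := by rw [Φ.norm_map, hu]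
  refine le_trans ?_ (hf.bump_le_equatorBump hΦu he (by rw [real_inner_comm, hpe]))
  have h1 : inner ℝ p u = ‖P‖ * inner ℝ e (Φ u) := by
    rw [← hΦe, Φ.inner_map_map, real_inner_smul_left, hpu u huθ, mul_inv_cancel_left₀ hPne]
  rcases le_total 0 (inner ℝ e (Φ u) : ℝ) with h | h
  · refine hf.mono (inner_mem_Icc_of_norm_one hp hu) (inner_mem_Icc_of_norm_one he hΦu) ?_
    rw [h1]
    exact mul_le_of_le_one_left h hPle
  · have : bump f p u = 0 := hf.support _ (by rw [h1]; nlinarith [norm_nonneg P])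
    rw [this]
    exact hf.bump_nonneg he hΦu

namespace IsBumpData

variable {n : ℕ} [NeZero n] {v : ℝ} {ξ : Fin n → E n}
  {R : Finset (Fin n) → (E n ≃ₗᵢ[ℝ] E n)} {k : Finset (Fin n) → ℕ} {f g : ℝ → ℝ} {ε : ℝ}

theorem lt_one (h : IsBumpData v ξ R k f g) : v < 1 / 10 ^ 3 := by
  refine h.small.trans_le ?_
  gcongr
  exact div_le_one_of_le₀ (one_le_pow₀ (by norm_num)) (by positivity)

theorem pow_four_le (h : IsBumpData v ξ R k f g) : v ^ 4 ≤ v ^ 2 / 10 ^ 6 := by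
  have h1 := h.lt_one
  have h2 := h.pos
  have h3 : v ^ 2 ≤ 1 / 10 ^ 6 := by nlinarith
  nlinarith [sq_nonneg v]

theorem sq_le (h : IsBumpData v ξ R k f g) : v ^ 2 ≤ v / 10 ^ 3 := by
  have h1 := h.lt_one
  have h2 := h.pos
  nlinarith

theorem cos_pow_four_pos (h : IsBumpData v ξ R k f g) : 0 < Real.cos (v ^ 4) := by
  have h1 := h.pow_four_le
  have h2 := h.sq_le
  have h3 := h.lt_one
  have h4 : 0 < v ^ 4 := pow_pos h.pos 4
  exact Real.cos_pos_of_mem_Ioo ⟨by linarith [Real.pi_pos], by linarith [Real.pi_gt_three]⟩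

theorem norm_map_eq (h : IsBumpData v ξ R k f g) (I : Finset (Fin n)) (i : Fin n) :
    ‖R I (ξ i)‖ = 1 := by
  rw [(R I).norm_map, h.simplex.norm_eq]

theorem bump_f_nonneg (h : IsBumpData v ξ R k f g) (i : Fin n) {u : E n} (hu : ‖u‖ = 1) :
    0 ≤ bump f (ξ i) u :=
  h.profile_f.bump_nonneg (h.simplex.norm_eq i) hu

theorem bump_g_nonneg (h : IsBumpData v ξ R k f g) (I : Finset (Fin n)) (i : Fin n) {u : E n}
    (hu : ‖u‖ = 1) : 0 ≤ bump g (R I (ξ i)) u :=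
  h.profile_g.bump_nonneg (h.norm_map_eq I i) hu

theorem one_le_radialK (h : IsBumpData v ξ R k f g) (hε : 0 < ε) {u : E n} (hu : ‖u‖ = 1) :
    1 ≤ radialK ε f ξ u :=
  le_add_of_nonneg_right
    (Finset.sum_nonneg fun i _ => mul_nonneg (by positivity) (h.bump_f_nonneg i hu))

theorem sum_f_nonneg (h : IsBumpData v ξ R k f g) (hε : 0 < ε) {u : E n} (hu : ‖u‖ = 1) :
    0 ≤ ∑ i ∈ Finset.univ.erase 0, ε / 10 ^ 3 * bump f (ξ i) u :=
  Finset.sum_nonneg fun i _ => mul_nonneg (by positivity) (h.bump_f_nonneg i hu)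

theorem sum_g_nonneg (h : IsBumpData v ξ R k f g) (hε : 0 < ε) {u : E n} (hu : ‖u‖ = 1) :
    0 ≤ ∑ I ∈ subConfigs n, ∑ i ∈ I, ε * bump g (R I (ξ i)) u :=
  Finset.sum_nonneg fun I _ => Finset.sum_nonneg fun i _ =>
    mul_nonneg hε.le (h.bump_g_nonneg I i hu)

theorem equator_nonneg (h : IsBumpData v ξ R k f g) (hε : 0 < ε) {u : E n} (hu : ‖u‖ = 1) :
    0 ≤ ε / 10 ^ 3 * equatorBump f (ξ 0) u :=
  mul_nonneg (by positivity) (h.profile_f.equatorBump_nonneg hu)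

theorem one_le_radialL (h : IsBumpData v ξ R k f g) (hε : 0 < ε) {u : E n} (hu : ‖u‖ = 1) :
    1 ≤ radialL ε f g ξ R u := by
  have h1 := h.sum_f_nonneg hε hu
  have h2 := h.sum_g_nonneg hε hu
  have h3 := h.equator_nonneg hε hu
  unfold radialL
  linarith

theorem isConvexBody_bodyK (h : IsBumpData v ξ R k f g) :
    ∃ ε₀ : ℝ, 0 < ε₀ ∧ ∀ ε, 0 < ε → ε < ε₀ → IsConvexBody (bodyK ε f ξ) := by
  have hC : SphereC11 fun u => ∑ i, (1 / 10 ^ 3 : ℝ) * bump f (ξ i) u :=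
    SphereC11.sum _ fun i _ => (h.profile_f.sphereC11_bump (h.simplex.norm_eq i)).const_mul _
  obtain ⟨ε₀, h0, hε₀⟩ := hC.isConvexBody fun u hu =>
    Finset.sum_nonneg fun i _ => mul_nonneg (by positivity) (h.bump_f_nonneg i hu)
  refine ⟨ε₀, h0, fun ε hε hlt => ?_⟩
  convert hε₀ ε hε hlt using 2
  unfold bodyK
  congr 1
  funext u
  rw [Finset.mul_sum]
  congr 1
  exact Finset.sum_congr rfl fun i _ => by ring

theorem isConvexBody_bodyL (h : IsBumpData v ξ R k f g) :
    ∃ ε₀ : ℝ, 0 < ε₀ ∧ ∀ ε, 0 < ε → ε < ε₀ → IsConvexBody (bodyL ε f g ξ R) := by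
  have hC : SphereC11 fun u => ∑ i ∈ Finset.univ.erase 0, (1 / 10 ^ 3 : ℝ) * bump f (ξ i) u
      + ∑ I ∈ subConfigs n, ∑ i ∈ I, bump g (R I (ξ i)) u
      + (1 / 10 ^ 3 : ℝ) * equatorBump f (ξ 0) u :=
    ((SphereC11.sum _ fun i _ =>
      (h.profile_f.sphereC11_bump (h.simplex.norm_eq i)).const_mul _).add
      (SphereC11.sum _ fun I _ => SphereC11.sum _ fun i _ =>
        h.profile_g.sphereC11_bump (h.norm_map_eq I i))).add
      ((h.profile_f.sphereC11_equatorBump h.cos_pow_four_pos (h.simplex.norm_eq 0)).const_mul _)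
  obtain ⟨ε₀, h0, hε₀⟩ := hC.isConvexBody fun u hu => by
    have h1 := h.sum_f_nonneg one_pos hu
    have h2 := h.sum_g_nonneg one_pos hu
    have h3 := h.equator_nonneg one_pos hu
    simp only [one_mul] at h2
    linarith
  refine ⟨ε₀, h0, fun ε hε hlt => ?_⟩
  convert hε₀ ε hε hlt using 2
  unfold bodyL
  congr 1
  funext u
  rw [mul_add, mul_add, Finset.mul_sum, Finset.mul_sum, ← add_assoc, ← add_assoc]
  congr 1
  · congr 1
    · congr 1
      exact Finset.sum_congr rfl fun i _ => by ring
    · exact Finset.sum_congr rfl fun I _ => by rw [Finset.mul_sum]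
  · ring

/-! ### Sections -/

/-- The bumps of `K` have disjoint supports. -/
theorem radialK_eq (h : IsBumpData v ξ R k f g) {u : E n} (hu : ‖u‖ = 1) :
    radialK ε f ξ u = 1 ∨ ∃ j, ‖u - ξ j‖ < v ^ 4 ∧ bump f (ξ j) u ≠ 0 ∧
      radialK ε f ξ u = 1 + ε / 10 ^ 3 * bump f (ξ j) u := by
  by_cases hall : ∀ j, bump f (ξ j) u = 0
  · left
    simp [radialK, hall]
  · right
    push Not at hall
    obtain ⟨j, hj⟩ := hall
    have hv4 := pow_pos h.pos 4
    have hju := h.profile_f.norm_sub_lt hv4 (h.simplex.norm_eq j) hu hj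
    refine ⟨j, hju, hj, ?_⟩
    rw [radialK, Finset.sum_eq_single j]
    · intro i _ hij
      by_contra hi
      have hiu := h.profile_f.norm_sub_lt hv4 (h.simplex.norm_eq i) hu (right_ne_zero_of_mul hi)
      have h1 := h.simplex.lt_norm_sub h.pos (by linarith [h.lt_one]) hij
      have h2 := norm_sub_le_norm_sub_add_norm_sub (ξ i) u (ξ j)
      rw [norm_sub_rev] at hiu
      have := h.pow_four_le
      have := h.sq_le
      have := h.pos
      linarith
    · simp

theorem abs_inner_le_of_bump_ne_zero (h : IsBumpData v ξ R k f g) {θ u : E n} (hθ : ‖θ‖ = 1)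
    (hu : ‖u‖ = 1) (huθ : inner ℝ u θ = 0) {i : Fin n} (hi : bump f (ξ i) u ≠ 0) :
    |inner ℝ θ (ξ i)| ≤ v ^ 4 := by
  have h1 := h.profile_f.norm_sub_lt (pow_pos h.pos 4) (h.simplex.norm_eq i) hu hi
  have h2 : inner ℝ θ (ξ i) = inner ℝ θ (ξ i - u) := by
    rw [inner_sub_right, real_inner_comm u θ, huθ, sub_zero]
  rw [h2]
  have h3 := abs_real_inner_le_norm θ (ξ i - u)
  rw [hθ, one_mul, norm_sub_rev] at h3
  linarith

/-- A bump of `K` has height at most `ε / 10 ^ 3`, which the wide bump of `L` still attains at angle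
`v ^ 2 / 2`; the chord `v ^ 2 / 4` is well inside that disk. -/
theorem radialK_le_radialL_of_close (h : IsBumpData v ξ R k f g) (hε : 0 < ε) {u w : E n}
    (hu : ‖u‖ = 1) (hw : ‖w‖ = 1) {I : Finset (Fin n)} (hI : I ∈ subConfigs n) {j : Fin n}
    (hj : j ∈ I) (hK : radialK ε f ξ u = 1 + ε / 10 ^ 3 * bump f (ξ j) u)
    (hclose : ‖w - R I (ξ j)‖ ≤ v ^ 2 / 4) : radialK ε f ξ u ≤ radialL ε f g ξ R w := by
  have hv := h.pos
  have hv1 := h.lt_one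
  have hv2 := h.sq_le
  have hRn := h.norm_map_eq I j
  have hcos := cos_le_one_sub_sq_div_four (v := v ^ 2 / 2) (by positivity) (by linarith)
  have hin : Real.cos (v ^ 2 / 2) ≤ inner ℝ (R I (ξ j)) w := by
    have h1 := norm_sub_sq_of_norm_one hw hRn
    rw [real_inner_comm] at h1
    have h2 : ‖w - R I (ξ j)‖ ^ 2 ≤ (v ^ 2 / 4) ^ 2 := by gcongr
    nlinarith [sq_nonneg (v ^ 2)]
  have hg : 1 / 10 ^ 3 ≤ bump g (R I (ξ j)) w :=
    h.half_height.trans (h.profile_g.mono ⟨Real.neg_one_le_cos _, Real.cos_le_one _⟩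
      (inner_mem_Icc_of_norm_one hRn hw) hin)
  have hterm : ε * bump g (R I (ξ j)) w
      ≤ ∑ I ∈ subConfigs n, ∑ i ∈ I, ε * bump g (R I (ξ i)) w := by
    refine le_trans ?_ (Finset.single_le_sum (f := fun I => ∑ i ∈ I, ε * bump g (R I (ξ i)) w)
      (fun J _ => Finset.sum_nonneg fun i _ => mul_nonneg hε.le (h.bump_g_nonneg J i hw)) hI)
    exact Finset.single_le_sum (f := fun i => ε * bump g (R I (ξ i)) w)
      (fun i _ => mul_nonneg hε.le (h.bump_g_nonneg I i hw)) hj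
  have h1 := h.sum_f_nonneg hε hw
  have h3 := h.equator_nonneg hε hw
  have h4 := h.profile_f.bump_le_one (h.simplex.norm_eq j) hu
  have h5 : ε / 10 ^ 3 * bump f (ξ j) u ≤ ε / 10 ^ 3 := mul_le_of_le_one_right (by positivity) h4
  have h6 : ε * (1 / 10 ^ 3) ≤ ε * bump g (R I (ξ j)) w := by gcongr
  rw [hK, radialL]
  linarith

/-- A direction almost orthogonal to the vertices in `I` is fixed by a rotation close to `R I`. -/
theorem exists_rotation_close (h : IsBumpData v ξ R k f g) {I : Finset (Fin n)}
    (hI : I ∈ subConfigs n) {θ : E n} (hθ : ‖θ‖ = 1)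
    (hθI : ∀ i ∈ I, |inner ℝ θ (ξ i)| ≤ v ^ 4) :
    ∃ Φ : E n ≃ₗᵢ[ℝ] E n, IsRotation Φ ∧ Φ θ = θ ∧
      ∀ u, ‖u‖ = 1 → ∀ j, ‖u - ξ j‖ ≤ v ^ 4 → ‖Φ u - R I (ξ j)‖ ≤ v ^ 2 / 4 := by
  have hv := h.pos
  have hv1 := h.lt_one
  set H : Submodule ℝ (E n) := Submodule.span ℝ (ξ '' I) with hH
  set x := H.starProjection θ with hx
  have hxH : x ∈ H := Submodule.starProjection_apply_mem _ _
  set y := θ - x with hy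
  have hyH : y ∈ Hᗮ := H.sub_starProjection_mem_orthogonal θ
  have hxn : ‖x‖ ≤ v ^ 2 / 500 := by
    have h1 := h.simplex.norm_sq_le_of_mem_span hv (by linarith) hxH (η := v ^ 4) fun i hi => by
      have h2 : inner ℝ x (ξ i) = inner ℝ θ (ξ i) := by
        have h3 : inner ℝ y (ξ i) = 0 := by
          rw [real_inner_comm]; exact hyH _ (Submodule.subset_span ⟨i, hi, rfl⟩)
        rw [hy, inner_sub_left] at h3
        linarith
      rw [h2]; exact hθI i hi
    have h2 := IsRegularSimplex.natCast_mul_le hv h.small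
    have h3 : ‖x‖ ^ 2 ≤ 4 * (n * v) * v * v ^ 4 := by
      have hv2 : 0 < v ^ 2 / 4 := by positivity
      refine le_of_mul_le_mul_left ?_ hv2
      calc _ ≤ _ := h1
        _ = _ := by ring
    -- Both `n * v` and `v` are at most `10⁻³`, so the bound becomes `(v ^ 2 / 500) ^ 2`.
    have h4 : 4 * (n * v) * v * v ^ 4 ≤ 4 * (1 / 10 ^ 3) * (1 / 10 ^ 3) * v ^ 4 := by gcongr
    refine (sq_le_sq₀ (norm_nonneg _) (by positivity)).1 ?_
    refine h3.trans (h4.trans (le_of_eq ?_))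
    ring
  have hyn : |‖y‖ - 1| ≤ ‖x‖ := by
    have h1 := abs_norm_sub_norm_le y θ
    rwa [hθ, hy, sub_sub_cancel_left, norm_neg] at h1
  have hv2 := h.sq_le
  have hypos : 0 < ‖y‖ := by
    have := (abs_le.1 hyn).1
    linarith
  -- A unit vector close to `θ` that `R I` fixes exactly; conjugating `R I` by a rotation `S` with
  -- `S η = θ` then fixes `θ`.
  set η := ‖y‖⁻¹ • y with hη
  have hηn : ‖η‖ = 1 := by rw [hη, norm_smul, norm_inv, norm_norm, inv_mul_cancel₀ hypos.ne']
  have hηθ : ‖η - θ‖ ≤ v ^ 2 / 250 := by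
    have h1 : ‖η - y‖ = |‖y‖ - 1| := by
      have e : η - y = (‖y‖⁻¹ * (1 - ‖y‖)) • y := by
        rw [hη, mul_sub, inv_mul_cancel₀ hypos.ne', mul_one, sub_smul, one_smul]
      rw [e, norm_smul, norm_mul, norm_inv, norm_norm, Real.norm_eq_abs, abs_sub_comm]
      field_simp
    have h2 : ‖y - θ‖ = ‖x‖ := by rw [hy, sub_sub_cancel_left, norm_neg]
    have h3 := norm_sub_le_norm_sub_add_norm_sub η y θ
    linarith
  have hinner : 0 ≤ inner ℝ η θ := by
    have h1 : inner ℝ y θ = ‖y‖ ^ 2 := by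
      have h2 : θ = y + x := by rw [hy, sub_add_cancel]
      have h3 : inner ℝ y x = 0 := by rw [real_inner_comm]; exact hyH x hxH
      conv_lhs => rw [h2]
      rw [inner_add_right, h3, real_inner_self_eq_norm_sq, add_zero]
    rw [hη, real_inner_smul_left, h1]
    positivity
  obtain ⟨S, hS, hSη, -, hSclose⟩ := exists_rotation_apply_eq hηn hθ hinner
  have hSinv : S⁻¹ θ = η := by rw [← hSη]; exact S.symm_apply_apply η
  have hRη : R I η = η := h.placement.within_span I hI η (Submodule.smul_mem _ _ hyH)
  refine ⟨S * R I * S⁻¹, (hS.mul (h.placement.rotation I hI)).mul hS.inv, ?_, ?_⟩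
  · change S (R I (S⁻¹ θ)) = θ
    rw [hSinv, hRη, hSη]
  · intro u hu j huj
    change ‖S (R I (S⁻¹ u)) - R I (ξ j)‖ ≤ _
    set z := S⁻¹ u with hz
    have hSz : S z = u := S.apply_symm_apply u
    have hzn : ‖z‖ = 1 := by rw [hz, LinearIsometryEquiv.norm_map, hu]
    have h1 := hSclose z
    have h2 := hSclose (R I z)
    rw [LinearIsometryEquiv.norm_map, hzn] at h2
    rw [hSz, hzn] at h1
    have h3 : ‖R I z - R I (ξ j)‖ = ‖z - ξ j‖ := by rw [← map_sub, LinearIsometryEquiv.norm_map]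
    have h4 := norm_sub_le_norm_sub_add_norm_sub (S (R I z)) (R I z) (R I (ξ j))
    have h5 := norm_sub_le_norm_sub_add_norm_sub z u (ξ j)
    rw [norm_sub_rev z u] at h5
    have h6 := h.pow_four_le
    have h7 := sq_nonneg v
    -- The conjugation moves points twice, each time by at most `4 * v ^ 2 / 250`; adding `v ^ 4`
    -- stays below `v ^ 2 / 4`.
    linarith

theorem sectionsRotateInto (h : IsBumpData v ξ R k f g) (hε : 0 < ε) :
    SectionsRotateInto (bodyK ε f ξ) (bodyL ε f g ξ R) := by
  classical
  intro θ hθ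
  have hL0 : ∀ u : E n, ‖u‖ = 1 → 0 ≤ radialL ε f g ξ R u := fun u hu =>
    zero_le_one.trans (h.one_le_radialL hε hu)
  suffices ∃ Φ : E n ≃ₗᵢ[ℝ] E n, IsRotation Φ ∧ Φ θ = θ ∧
      ∀ u, ‖u‖ = 1 → inner ℝ u θ = 0 → radialK ε f ξ u ≤ radialL ε f g ξ R (Φ u) by
    obtain ⟨Φ, hΦ, hΦθ, hle⟩ := this
    exact rotatesIntoAbout_section hL0 hΦ hΦθ hle
  set I : Finset (Fin n) :=
    Finset.univ.filter fun i => ∃ u : E n, ‖u‖ = 1 ∧ inner ℝ u θ = 0 ∧ bump f (ξ i) u ≠ 0 with hI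
  have hmemI : ∀ u : E n, ‖u‖ = 1 → inner ℝ u θ = 0 → ∀ i, bump f (ξ i) u ≠ 0 → i ∈ I :=
    fun u hu huθ i hi => Finset.mem_filter.2 ⟨Finset.mem_univ i, u, hu, huθ, hi⟩
  have hθI : ∀ i ∈ I, |inner ℝ θ (ξ i)| ≤ v ^ 4 := fun i hi => by
    obtain ⟨u, hu, huθ, hne⟩ := (Finset.mem_filter.1 hi).2
    exact h.abs_inner_le_of_bump_ne_zero hθ hu huθ hne
  by_cases h0 : (0 : Fin n) ∈ I
  swap
  · refine ⟨1, isRotation_one, rfl, fun u hu huθ => ?_⟩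
    have hb : bump f (ξ 0) u = 0 := by
      by_contra hne
      exact h0 (hmemI u hu huθ 0 hne)
    have h2 := h.sum_g_nonneg hε hu
    have h3 := h.equator_nonneg hε hu
    change radialK ε f ξ u ≤ radialL ε f g ξ R u
    rw [radialK, ← Finset.add_sum_erase _ _ (Finset.mem_univ (0 : Fin n)), hb, radialL]
    linarith
  have hcard : I.card < n := by
    obtain ⟨i, hi⟩ := h.simplex.exists_lt_abs_inner h.pos h.small hθ
    have hiI : i ∉ I := fun hmem => absurd (hθI i hmem) (not_le.2 hi)
    simpa using Finset.card_lt_univ_of_notMem hiI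
  by_cases h2 : 2 ≤ I.card
  · have hIsub : I ∈ subConfigs n := Finset.mem_filter.2 ⟨Finset.mem_univ _, h0, h2, hcard⟩
    obtain ⟨Φ, hΦ, hΦθ, hclose⟩ := h.exists_rotation_close hIsub hθ hθI
    refine ⟨Φ, hΦ, hΦθ, fun u hu huθ => ?_⟩
    have hΦu : ‖Φ u‖ = 1 := by rw [Φ.norm_map, hu]
    rcases h.radialK_eq (ε := ε) hu with hK | ⟨j, hju, hj, hK⟩
    · rw [hK]; exact h.one_le_radialL hε hΦu
    · exact h.radialK_le_radialL_of_close hε hu hΦu hIsub (hmemI u hu huθ j hj) hK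
        (hclose u hu j hju.le)
  · obtain ⟨Φ, hΦ, hΦθ, hle⟩ := h.profile_f.exists_rotation_le_equatorBump h.three_le
      h.cos_pow_four_pos.le (h.simplex.norm_eq 0) hθ
    refine ⟨Φ, hΦ, hΦθ, fun u hu huθ => ?_⟩
    have hΦu : ‖Φ u‖ = 1 := by rw [Φ.norm_map, hu]
    rcases h.radialK_eq (ε := ε) hu with hK | ⟨j, hju, hj, hK⟩
    · rw [hK]; exact h.one_le_radialL hε hΦu
    · have hj0 : j = 0 :=
        Finset.card_le_one.1 (by omega) j (hmemI u hu huθ j hj) 0 h0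
      subst hj0
      have h1 := h.sum_f_nonneg hε hΦu
      have h3 := h.sum_g_nonneg hε hΦu
      have h4 : ε / 10 ^ 3 * bump f (ξ 0) u ≤ ε / 10 ^ 3 * equatorBump f (ξ 0) (Φ u) :=
        mul_le_mul_of_nonneg_left (hle u hu huθ) (by positivity)
      rw [hK, radialL]
      linarith

end IsBumpData

/-! ### No rotation of `K` lies in `L` -/

namespace IsBumpData

variable {n : ℕ} [NeZero n] {v : ℝ} {ξ : Fin n → E n}
  {R : Finset (Fin n) → (E n ≃ₗᵢ[ℝ] E n)} {k : Finset (Fin n) → ℕ} {f g : ℝ → ℝ} {ε : ℝ}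

/-- Where `L` exceeds the ball, one is near a vertex of the simplex, near a vertex of a layered
copy, or near the equator. -/
theorem trichotomy_of_one_lt_radialL (h : IsBumpData v ξ R k f g) {u : E n}
    (hu : ‖u‖ = 1) (hL : 1 < radialL ε f g ξ R u) :
    (∃ i ∈ Finset.univ.erase (0 : Fin n), ‖u - ξ i‖ < v ^ 4) ∨
      (∃ I ∈ subConfigs n, u ∈ layer (ξ 0) (k I) ∧ ∃ i ∈ I, ‖u - R I (ξ i)‖ < v ^ 2) ∨
      |inner ℝ (ξ 0) u| ≤ v ^ 4 := by
  by_contra! hcon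
  obtain ⟨h1, h2, h3⟩ := hcon
  have hv4 : 0 < v ^ 4 := pow_pos h.pos 4
  have hv2 : 0 < v ^ 2 := pow_pos h.pos 2
  have e1 : ∑ i ∈ Finset.univ.erase 0, ε / 10 ^ 3 * bump f (ξ i) u = 0 :=
    Finset.sum_eq_zero fun i hi => by
      by_contra hne
      exact absurd (h.profile_f.norm_sub_lt hv4 (h.simplex.norm_eq i) hu
        (right_ne_zero_of_mul hne)) (not_lt.2 (h1 i hi))
  have e2 : ∑ I ∈ subConfigs n, ∑ i ∈ I, ε * bump g (R I (ξ i)) u = 0 :=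
    Finset.sum_eq_zero fun I hI => Finset.sum_eq_zero fun i hi => by
      by_contra hne
      have hb : bump g (R I (ξ i)) u ≠ 0 := right_ne_zero_of_mul hne
      have hnear := h.profile_g.norm_sub_lt hv2 (h.norm_map_eq I i) hu hb
      refine absurd hnear (not_lt.2 (h2 I hI ?_ i hi))
      refine h.placement.mem_layer I hI i hi u hu ?_
      have hcos : Real.cos (v ^ 2) ≤ inner ℝ (R I (ξ i)) u := by
        by_contra hle
        exact hb (h.profile_g.support _ (not_le.1 hle).le)
      rw [InnerProductGeometry.angle, h.norm_map_eq, hu, mul_one, div_one]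
      have hlt := h.lt_one
      have hsq := h.sq_le
      have := Real.arccos_le_arccos hcos
      rwa [Real.arccos_cos hv2.le (by linarith [Real.pi_gt_three])] at this
  have e3 : equatorBump f (ξ 0) u = 0 := by
    by_contra hne
    obtain ⟨e, he, he0, heb⟩ := IsBumpProfile.exists_bump_ne_zero_of_equatorBump hne
    have hnear := h.profile_f.norm_sub_lt hv4 he hu heb
    have hin : inner ℝ (ξ 0) u = inner ℝ (ξ 0) (u - e) := by
      rw [inner_sub_right, real_inner_comm e (ξ 0), he0, sub_zero]
    have := abs_real_inner_le_norm (ξ 0) (u - e)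
    rw [← hin, h.simplex.norm_eq, one_mul] at this
    linarith
  rw [radialL, e1, e2, e3] at hL
  simp at hL

theorem one_lt_radialK (h : IsBumpData v ξ R k f g) (hε : 0 < ε) (i : Fin n) :
    1 < radialK ε f ξ (ξ i) := by
  have h1 := Finset.single_le_sum (f := fun j => ε / 10 ^ 3 * bump f (ξ j) (ξ i))
    (fun j _ => mul_nonneg (by positivity) (h.bump_f_nonneg j (h.simplex.norm_eq i)))
    (Finset.mem_univ i)
  simp only [h.profile_f.bump_self (h.simplex.norm_eq i), mul_one] at h1
  have : 0 < ε / 10 ^ 3 := by positivity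
  rw [radialK]
  linarith

/-- An even index in the allowed range lies between `2` and `2 ^ n - 2`, which keeps the copies away
from both the equator and the pole. -/
theorem layer_bounds (h : IsBumpData v ξ R k f g) {I : Finset (Fin n)} (hI : I ∈ subConfigs n)
    {u : E n} (hu : u ∈ layer (ξ 0) (k I)) :
    1 / 2 ^ n ≤ (inner ℝ (ξ 0) u : ℝ) ∧ (inner ℝ (ξ 0) u : ℝ) ≤ 1 - 2 * (1 / 2 ^ n) := by
  obtain ⟨-, h1, h2⟩ := hu
  obtain ⟨m, hm⟩ := h.placement.index_even I hI
  obtain ⟨h3, h4⟩ := h.placement.index_range I hI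
  have h5 : 2 ^ n = 2 * 2 ^ (n - 1) := by
    rw [← pow_succ', Nat.sub_add_cancel NeZero.one_le]
  have h6 : (2 : ℝ) ≤ k I := by exact_mod_cast (by omega : 2 ≤ k I)
  have h7 : (k I : ℝ) + 2 ≤ 2 ^ n := by exact_mod_cast (by omega : k I + 2 ≤ 2 ^ n)
  refine ⟨le_trans ?_ h1, h2.trans ?_⟩
  · gcongr; linarith
  · rw [div_le_iff₀ (by positivity), sub_mul, mul_assoc, one_div_mul_cancel (by positivity)]
    linarith

/-- Distinct even layers are separated by a full odd layer, of thickness `1 / 2 ^ n`, which exceeds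
`v`. -/
theorem eq_of_mem_layer (h : IsBumpData v ξ R k f g) {I J : Finset (Fin n)}
    (hI : I ∈ subConfigs n) (hJ : J ∈ subConfigs n) {a b : E n} (ha : a ∈ layer (ξ 0) (k I))
    (hb : b ∈ layer (ξ 0) (k J)) (hab : |(inner ℝ (ξ 0) a : ℝ) - inner ℝ (ξ 0) b| ≤ v) :
    I = J := by
  refine h.placement.index_inj hI hJ ?_
  have hv := lt_one_div_two_pow h.small
  have hpow : (0 : ℝ) < 1 / 2 ^ n := by positivity
  obtain ⟨-, h1, h2⟩ := ha
  obtain ⟨-, h3, h4⟩ := hb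
  obtain ⟨h5, h6⟩ := abs_le.1 hab
  obtain ⟨i, hi⟩ := h.placement.index_even I hI
  obtain ⟨j, hj⟩ := h.placement.index_even J hJ
  have key : ∀ x y : ℝ, x * (1 / 2 ^ n) - y * (1 / 2 ^ n) < 1 / 2 ^ n → x < y + 1 :=
    fun x y hxy => by
      by_contra hle
      nlinarith
  rw [div_eq_mul_one_div] at h1 h2 h3 h4
  have h7 : (k I : ℝ) - 1 < k J + 1 := key _ _ (by linarith)
  have h8 : (k J : ℝ) - 1 < k I + 1 := key _ _ (by linarith)
  have h9 : k I < k J + 2 := by exact_mod_cast (by linarith : (k I : ℝ) < k J + 2)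
  have h10 : k J < k I + 2 := by exact_mod_cast (by linarith : (k J : ℝ) < k I + 2)
  omega

/-- Two vertices near the same centre would be within `2 * v ^ 2` of each other, while distinct
vertices are more than `v / 2` apart. -/
theorem pigeonhole_vertices (h : IsBumpData v ξ R k f g) {ζ : Fin n → E n}
    (hζ : IsRegularSimplex v ζ) {s : Finset (Fin n)} (hs : s.card < n) (c : Fin n → E n) {r : ℝ}
    (hr : r ≤ v ^ 2) (hnear : ∀ i, ∃ j ∈ s, ‖ζ i - c j‖ < r) : False := by
  choose p hps hp using hnear
  obtain ⟨a, -, b, -, hab, hpab⟩ := Finset.exists_ne_map_eq_of_card_lt_of_maps_to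
    (s := Finset.univ) (t := s) (by simpa using hs) (f := p) fun i _ => hps i
  have h1 := hζ.lt_norm_sub h.pos (by linarith [h.lt_one]) hab
  have h2 := norm_sub_le_norm_sub_add_norm_sub (ζ a) (c (p a)) (ζ b)
  have h3 := hp a
  have h4 := hp b
  rw [← hpab, norm_sub_rev] at h4
  have h5 := h.sq_le
  have h6 := h.pos
  linarith

theorem not_containsRotationOf (h : IsBumpData v ξ R k f g) (hε : 0 < ε) :
    ¬ ContainsRotationOf (bodyL ε f g ξ R) (bodyK ε f ξ) := by
  refine not_containsRotationOf_of_radial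
    (fun u hu => zero_le_one.trans (h.one_le_radialK hε hu))
    (fun u hu => zero_le_one.trans (h.one_le_radialL hε hu)) fun Ψ => ?_
  change ∃ u, ‖u‖ = 1 ∧ radialL ε f g ξ R (Ψ u) < radialK ε f ξ u
  by_contra! hcon
  set ζ : Fin n → E n := fun i => Ψ (ξ i) with hζdef
  have hζ : IsRegularSimplex v ζ := h.simplex.map Ψ
  have htri := fun i => h.trichotomy_of_one_lt_radialL (hζ.norm_eq i)
    ((h.one_lt_radialK hε i).trans_le (hcon (ξ i) (h.simplex.norm_eq i)))
  have hv := h.pos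
  have hv1 := h.lt_one
  have hv2 := h.sq_le
  have hv4 := h.pow_four_le
  have hvt := lt_one_div_two_pow h.small
  set t : ℝ := 1 / 2 ^ n with ht
  have ht1 : t ≤ 1 := div_le_one_of_le₀ (one_le_pow₀ (by norm_num)) (by positivity)
  have hheight : ∀ i j, |(inner ℝ (ξ 0) (ζ i) : ℝ) - inner ℝ (ξ 0) (ζ j)| ≤ v := fun i j => by
    rw [← inner_sub_right]
    have h1 := abs_real_inner_le_norm (ξ 0) (ζ i - ζ j)
    rw [h.simplex.norm_eq, one_mul] at h1
    exact h1.trans (hζ.norm_sub_le hv i j)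
  have htop : ∀ i, (∃ j ∈ Finset.univ.erase (0 : Fin n), ‖ζ i - ξ j‖ < v ^ 4) →
      1 - v < (inner ℝ (ξ 0) (ζ i) : ℝ) := by
    rintro i ⟨j, hj, hij⟩
    have h1 := h.simplex.inner_eq 0 j
    rw [if_neg (Finset.ne_of_mem_erase hj).symm, add_zero] at h1
    have h2 := Real.one_sub_sq_div_two_le_cos (x := v)
    have h3 := abs_real_inner_le_norm (ξ 0) (ζ i - ξ j)
    rw [h.simplex.norm_eq, one_mul, inner_sub_right] at h3
    have h4 := (abs_le.1 h3).1
    linarith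
  have hbot : ∀ i, |(inner ℝ (ξ 0) (ζ i) : ℝ)| ≤ v ^ 4 → (inner ℝ (ξ 0) (ζ i) : ℝ) ≤ v :=
    fun i hi => by linarith [le_abs_self (inner ℝ (ξ 0) (ζ i) : ℝ)]
  -- The heights of the moved vertices differ by at most `v`, so the family containing vertex `0`
  -- contains them all.
  rcases htri 0 with h0 | ⟨I, hI, h0, -⟩ | h0
  · refine h.pigeonhole_vertices hζ (s := Finset.univ.erase 0) ?_ ξ (r := v ^ 4)
      (by nlinarith) fun i => ?_
    · rw [Finset.card_erase_of_mem (Finset.mem_univ _), Finset.card_univ, Fintype.card_fin]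
      exact Nat.sub_lt (NeZero.pos n) one_pos
    · have h1 := htop 0 h0
      have h2 := (abs_le.1 (hheight 0 i)).2
      rcases htri i with hi | ⟨J, hJ, hi, -⟩ | hi
      · exact hi
      · have := (h.layer_bounds hJ hi).2
        linarith
      · have := hbot i hi
        linarith
  · refine h.pigeonhole_vertices hζ (Finset.mem_filter.1 hI).2.2.2 (fun i => R I (ξ i))
      le_rfl fun i => ?_
    obtain ⟨h1, h2⟩ := h.layer_bounds hI h0
    obtain ⟨h3, h4⟩ := abs_le.1 (hheight 0 i)
    rcases htri i with hi | ⟨J, hJ, hi, hnear⟩ | hi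
    · have := htop i hi
      linarith
    · obtain rfl := h.eq_of_mem_layer hI hJ h0 hi (hheight 0 i)
      exact hnear
    · have := hbot i hi
      linarith
  -- Some moved vertex is off the equatorial band, yet its height is at most `2 * v`, too low for
  -- any layer or for the vertices near the pole.
  · obtain ⟨i, hi⟩ := hζ.exists_lt_abs_inner hv h.small (h.simplex.norm_eq 0)
    have h1 := hbot 0 h0
    have h2 := (abs_le.1 (hheight 0 i)).1
    rcases htri i with hi' | ⟨J, hJ, hi', -⟩ | hi'
    · have := htop i hi'
      linarith
    · have := (h.layer_bounds hJ hi').1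
      linarith
    · linarith

end IsBumpData
end BumpBodies

/-! ### Assembly of the main theorem -/

open BumpBodies
theorem mainTheorem2 (n : ℕ) [NeZero n] (hn : 3 ≤ n) (v : ℝ) (hv : 0 < v)
    (hvn : v < 1 / 4 ^ n / 10 ^ 3) :
    -- the ingredients exist
    (∃ ξ : Fin n → E n, IsRegularSimplex v ξ) ∧
    (∃ f g : ℝ → ℝ, IsBumpProfile (v ^ 4) f ∧ IsBumpProfile (v ^ 2) g ∧
      1 / 10 ^ 3 ≤ g (Real.cos (v ^ 2 / 2))) ∧
    (∀ ξ : Fin n → E n, IsRegularSimplex v ξ → ∃ R k, IsLayeredPlacement v ξ R k) ∧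
    -- for every choice of them and every small height, the two bodies are counterexamples
    (∀ ξ : Fin n → E n, IsRegularSimplex v ξ →
      ∀ (R : Finset (Fin n) → (E n ≃ₗᵢ[ℝ] E n)) (k : Finset (Fin n) → ℕ),
        IsLayeredPlacement v ξ R k →
      ∀ f g : ℝ → ℝ, IsBumpProfile (v ^ 4) f → IsBumpProfile (v ^ 2) g →
        1 / 10 ^ 3 ≤ g (Real.cos (v ^ 2 / 2)) →
      ∃ ε₀ : ℝ, 0 < ε₀ ∧ ∀ ε : ℝ, 0 < ε → ε < ε₀ →
        (IsConvexBody (bodyK ε f ξ) ∧ IsConvexBody (bodyL ε f g ξ R) ∧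
          SectionsRotateInto (bodyK ε f ξ) (bodyL ε f g ξ R) ∧
          ¬ ContainsRotationOf (bodyL ε f g ξ R) (bodyK ε f ξ)) ∧
        (IsConvexBody (polarSet (bodyL ε f g ξ R)) ∧ IsConvexBody (polarSet (bodyK ε f ξ)) ∧
          ProjectionsRotateInto (polarSet (bodyL ε f g ξ R)) (polarSet (bodyK ε f ξ)) ∧
          ¬ ContainsRotationOf (polarSet (bodyK ε f ξ)) (polarSet (bodyL ε f g ξ R)))) := by
  have hv1 : v ≤ 1 := by
    refine hvn.le.trans ?_
    rw [div_div]
    refine div_le_one_of_le₀ (one_le_mul_of_one_le_of_one_le (one_le_pow₀ (by norm_num))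
      (by norm_num)) (by positivity)
  refine ⟨exists_isRegularSimplex n hv hv1, ?_,
    fun ξ hξ => exists_isLayeredPlacement hv hvn hξ, ?_⟩
  · obtain ⟨f, hf, -⟩ := exists_bumpProfile (pow_pos hv 4) (pow_le_one₀ hv.le hv1)
    obtain ⟨g, hg, hg1⟩ := exists_bumpProfile (pow_pos hv 2) (pow_le_one₀ hv.le hv1)
    exact ⟨f, g, hf, hg, by rw [hg1]; norm_num⟩
  · intro ξ hξ R k hR f g hf hg hhalf
    have h : IsBumpData v ξ R k f g := ⟨hn, hv, hvn, hξ, hR, hf, hg, hhalf⟩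
    obtain ⟨ε₁, hε₁, hK⟩ := h.isConvexBody_bodyK
    obtain ⟨ε₂, hε₂, hL⟩ := h.isConvexBody_bodyL
    refine ⟨min ε₁ ε₂, lt_min hε₁ hε₂, fun ε hε hlt => ?_⟩
    have hKc := hK ε hε (hlt.trans_le (min_le_left _ _))
    have hLc := hL ε hε (hlt.trans_le (min_le_right _ _))
    have hKball : Metric.closedBall 0 1 ⊆ bodyK ε f ξ :=
      closedBall_subset_bodyOfRadial fun u hu => h.one_le_radialK hε hu
    have hLball : Metric.closedBall 0 1 ⊆ bodyL ε f g ξ R :=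
      closedBall_subset_bodyOfRadial fun u hu => h.one_le_radialL hε hu
    have hsec := h.sectionsRotateInto hε
    have hnot := h.not_containsRotationOf hε
    exact ⟨⟨hKc, hLc, hsec, hnot⟩, isConvexBody_polarSet hLball hLc.1.isBounded,
      isConvexBody_polarSet hKball hKc.1.isBounded, hsec.polarSet hKc.2.2.2 hKball,
      not_containsRotationOf_polarSet hLc.1.isClosed hLc.2.2.2
        (hLball (Metric.mem_closedBall_self zero_le_one)) hnot⟩
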